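/- Let $\mathcal R=\langle R;+,<,\dots\rangle$ be an expansion, in a language $\mathcal L$, of a divisible ordered Abelian group. Assume that $\mathcal R$ is definably complete (every nonempty definable subset of $R$ that is bounded above has a supremum in $R$; "definable" always means "definable with parameters") and that the complete theory of $\mathcal R$ has burden $2$ (in a single variable, there is an inp-pattern of depth $2$ but none of depth $3$). Let $D\subseteq R$ be definable and discrete in the order topology. Write $S(a)=\min\{b\in D: b>a\}$ for the successor of a non-maximal $a\in D$, $S^{-1}$ for the predecessor, $\gamma_D(a)=S(a)-a$, and $D'=\{\gamma_D(a): a\in D\text{ not maximal}\}$. The $\mathbb Z$-chain of $a\in D$ is the set of all $S^n(a)$, $n\in\mathbb Z$, that exist. For a $\mathbb Z$-chain $Z$, a right period of $Z$ is an integer $l\ge 1$ such that for some $a_0\in Z$ we have $\gamma_D(S^{l}(b))=\gamma_D(b)$ for all $b\in Z$ with $b>a_0$; a left period is an integer $l\ge 1$ such that for some $a_1\in Z$ we have $\gamma_D(S^{-l}(b))=\gamma_D(b)$ for all $b\in Z$ with $b<a_1$. (If $Z$ has a greatest element, every $l\ge1$ is vacuously a right period; similarly on the left.) $Z$ is eventually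 periodic if it has a right period and a left period. For a finite sequence $\sigma=\langle c_1,\dots,c_n\rangle$ of elements of $D'$ let $P_\sigma$ be the set of $d\in D$ such that $S^{i}(d)-S^{i-1}(d)=c_i$ for $1\le i\le n$. Then there is a least $m_0^*\in\mathbb N$ such that for every $\mathbb Z$-chain $Z$ of $D$ and all sufficiently large $n$ there are at most $m_0^*$ sequences $\sigma$ of length $n$ from $D'$ for which $P_\sigma\cap Z$ is not bounded above in $Z$, and there is a least $m_1^*\in\mathbb N$ with the same property for "not bounded below". Moreover, every $\mathbb Z$-chain $Z$ of $D$ is eventually periodic, and there are $m_0(Z)\le m_0^*$ and $m_1(Z)\le m_1^*$ in $\mathbb N$ such that for all sufficiently large $n$ there are exactly $m_0(Z)$ (respectively, $m_1(Z)$) sequences $\sigma$ of length $n$ from $D'$ for which $P_\sigma\cap Z$ is not bounded above (respectively, below) in $Z$; if $Z$ has no greatest element, then $m_0(Z)$ is a right period of $Z$, and if $Z$ has no least element, then $m_1(Z)$ is a left period of $Z$. -/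

import Mathlib

open FirstOrder Filter

universe u v w

section ModelTheory

/-- An inp-pattern in the single variable `x`, with rows indexed by `ι`, and with parameters from
the structure `M`: every row is `k i`-inconsistent and every path through the rows is consistent
(i.e. finitely satisfiable in `M`). -/
structure InpPattern (L : FirstOrder.Language.{u, v}) (M : Type w) [L.Structure M] (ι : Type) where
  /-- the length of the parameter tuple of the `i`-th formula -/
  arity : ι → ℕ
  /-- the formula `φ_i (x; y)` -/
  formula : ∀ i, L.Formula (Unit ⊕ Fin (arity i))
  k : ι → ℕ
  k_pos : ∀ i, 0 < k i
  /-- the parameter tuples `a_{i,j}` -/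
  param : ∀ i, ℕ → Fin (arity i) → M
  row_inconsistent : ∀ i, ∀ s : Finset ℕ, s.card = k i →
    ¬ ∃ x : M, ∀ j ∈ s, (formula i).Realize (Sum.elim (fun _ => x) (param i j))
  path_consistent : ∀ (η : ι → ℕ) (s : Finset ι),
    ∃ x : M, ∀ i ∈ s, (formula i).Realize (Sum.elim (fun _ => x) (param i (η i)))

/-- The burden of `T` (that is, of the partial type `x = x` in a single variable) is less than `κ`:
no model of `T` has an inp-pattern of depth `κ`. (By compactness
and the Löwenheim-Skolem theorem the choice of the universe `w` does not matter.) -/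
def BurdenLT {L : FirstOrder.Language.{u, v}} (T : L.Theory) (κ : Cardinal.{0}) : Prop :=
  ∀ (M : Language.Theory.ModelType.{u, v, max u v w} T) (ι : Type), Cardinal.mk ι = κ →
    IsEmpty (InpPattern L M ι)

/-- The burden of `T` is the cardinal `c`: the least `κ` such that the burden of `T` is less
than `κ` is the successor of `c`. -/
def HasBurden {L : FirstOrder.Language.{u, v}} (T : L.Theory) (c : Cardinal.{0}) : Prop :=
  IsLeast {κ | BurdenLT.{u, v, w} T κ} (Order.succ c)

/-- The `L`-structure on `R` is an expansion of `⟨R; +, <⟩`. -/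
def ExpandsOAG (L : FirstOrder.Language.{u, v}) (R : Type w) [AddCommGroup R] [LinearOrder R]
    [L.Structure R] : Prop :=
  (∃ f : L.Functions 2, ∀ x y : R, Language.Structure.funMap f ![x, y] = x + y) ∧
  (∃ r : L.Relations 2, ∀ x y : R, Language.Structure.RelMap r ![x, y] ↔ x < y)

/-- Every nonempty, bounded above subset of `R` definable with parameters has a supremum in `R`. -/
def DefinablyComplete (L : FirstOrder.Language.{u, v}) (R : Type w) [LinearOrder R] [L.Structure R] : Prop :=
  ∀ X : Set R, (Set.univ : Set R).Definable₁ L X → X.Nonempty → BddAbove X → ∃ b, IsLUB X b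

end ModelTheory

section Chains

variable {R : Type w} [AddCommGroup R] [LinearOrder R]

open Classical in
/-- `S_D(a)`, the least element of `D` above `a`; its value is `a` if there is none. -/
noncomputable def succIn (D : Set R) (a : R) : R :=
  if h : ∃ b, IsLeast {b | b ∈ D ∧ a < b} b then h.choose else a

open Classical in
/-- `S_D⁻¹(a)`, the greatest element of `D` below `a`; its value is `a` if there is none. -/
noncomputable def predIn (D : Set R) (a : R) : R :=
  if h : ∃ b, IsGreatest {b | b ∈ D ∧ b < a} b then h.choose else a

/-- The difference `γ_D(a) = S_D(a) - a`. -/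
noncomputable def gap (D : Set R) (a : R) : R := succIn D a - a

/-- The difference set `D' = {γ_D(a) : a ∈ D not maximal}`. -/
def diffSet (D : Set R) : Set R := {c | ∃ a ∈ D, (∃ b ∈ D, a < b) ∧ gap D a = c}

/-- The `ℤ`-chain of `a` in `D`. (As `succIn` and `predIn` fix the greatest and the least element,
iterating them beyond an end of `D` adds no point.) -/
def zChain (D : Set R) (a : R) : Set R :=
  {b | ∃ n : ℕ, b = (succIn D)^[n] a ∨ b = (predIn D)^[n] a}

/-- `l` is a right period of the chain `Z` of `D`. -/
def HasRightPeriod (D Z : Set R) (l : ℕ) : Prop :=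
  0 < l ∧ ∃ a₀ ∈ Z, ∀ b ∈ Z, a₀ < b → gap D ((succIn D)^[l] b) = gap D b

/-- `l` is a left period of the chain `Z` of `D`. -/
def HasLeftPeriod (D Z : Set R) (l : ℕ) : Prop :=
  0 < l ∧ ∃ a₁ ∈ Z, ∀ b ∈ Z, b < a₁ → gap D ((predIn D)^[l] b) = gap D b

def EventuallyPeriodic (D Z : Set R) : Prop :=
  (∃ l₀, HasRightPeriod D Z l₀) ∧ ∃ l₁, HasLeftPeriod D Z l₁

/-- `P_σ`: the points of `D` from which the next `n` differences are `σ 0, …, σ (n - 1)`. -/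
def patternSet (D : Set R) {n : ℕ} (σ : Fin n → R) : Set R :=
  {d | d ∈ D ∧ ∀ l : Fin n, gap D ((succIn D)^[(l : ℕ)] d) = σ l}

/-- The sequences `σ` of length `n` from `D'` such that `P_σ` is not bounded above in `Z`. -/
def patternsUnboundedAbove (D Z : Set R) (n : ℕ) : Set (Fin n → R) :=
  {σ | (∀ i, σ i ∈ diffSet D) ∧ ¬ ∃ b ∈ Z, ∀ c ∈ patternSet D σ ∩ Z, c ≤ b}

/-- The sequences `σ` of length `n` from `D'` such that `P_σ` is not bounded below in `Z`. -/
def patternsUnboundedBelow (D Z : Set R) (n : ℕ) : Set (Fin n → R) :=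
  {σ | (∀ i, σ i ∈ diffSet D) ∧ ¬ ∃ b ∈ Z, ∀ c ∈ patternSet D σ ∩ Z, b ≤ c}

end Chains

/-! The engine is a finitary form of the burden bound: by an ultraproduct, for fixed definable
shapes there is an `N` such that `R` contains no array of three rows of `N` pairwise disjoint sets
in which every path has a common point (`exists_bound_of_burdenLT`). Every use builds such an array
by reading three independent "digits" off a point `x`: a coarse position, a finer position, and an
offset inside a smallest cell, the last digit being available because the group is divisible.

First use (`exists_bound_two_scales`): coarse cells `[d, d + r)` with `d ∈ D`, and inside them finer
cells of width `s` placed at the points of another definable set. If `D` accumulated at a point, `D`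
near that point could supply both scales. So `D` has no accumulation point, and definable
completeness gives least and greatest elements of bounded nonempty definable subsets
(`DefWellOrdered`), hence successors. If `D` had too many differences, the points followed by large
gaps would give the coarse scale and the small differences, viewed as points, the fine one; so `D'`
is finite (`finite_diffSet`).

Second use (`exists_bound_words`): the digits are an interval containing `x`, the word of
differences following the last point of `D` before `x`, and the offset from that point. Matching a
word is expressed by comparing two translates of `D` on an interval, a formula that does not depend
on the length of the word. Hence one `M` bounds, for all lengths and all chains, the number of words
recurring towards an end.

The rest is a Morse–Hedlund argument (`exists_period_of_recurrentWords`): the number of recurrent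
words of length `n` is nondecreasing and bounded, so it stabilises at some `m`; then each long
recurrent word has only one recurrent extension, and the sequence of differences eventually runs
through the `m` words cyclically. -/

/-! ### Closure properties of definability with parameters. -/

section Definability

variable {L : FirstOrder.Language.{u, v}} {R : Type w} [L.Structure R] {α : Type*}

/-- The predicate `P` on tuples is definable with parameters. -/
def DefPred (L : FirstOrder.Language.{u, v}) {R : Type w} [L.Structure R] {α : Type*}
    (P : (α → R) → Prop) : Prop :=
  (Set.univ : Set R).Definable L {v | P v}

/-- The function `f` on tuples is definable with parameters. -/
def DefTerm (L : FirstOrder.Language.{u, v}) {R : Type w} [L.Structure R] {α : Type*}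
    (f : (α → R) → R) : Prop :=
  (Set.univ : Set R).DefinableFun L f

theorem DefTerm.proj (i : α) : DefTerm L (fun v : α → R => v i) :=
  Set.DefinableFun.proj L

theorem DefTerm.const (a : R) : DefTerm L (fun _ : α → R => a) :=
  L.definableFun_const α (Set.mem_univ a)

theorem DefPred.and {P Q : (α → R) → Prop} (hP : DefPred L P) (hQ : DefPred L Q) :
    DefPred L (fun v => P v ∧ Q v) :=
  Set.Definable.inter hP hQ

theorem DefPred.or {P Q : (α → R) → Prop} (hP : DefPred L P) (hQ : DefPred L Q) :
    DefPred L (fun v => P v ∨ Q v) :=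
  Set.Definable.union hP hQ

theorem DefPred.not {P : (α → R) → Prop} (hP : DefPred L P) : DefPred L (fun v => ¬ P v) :=
  Set.Definable.compl hP

theorem DefPred.congr {P Q : (α → R) → Prop} (hP : DefPred L P) (h : ∀ v, Q v ↔ P v) :
    DefPred L Q := by
  rwa [show Q = P from funext fun v => propext (h v)]

theorem DefPred.imp {P Q : (α → R) → Prop} (hP : DefPred L P) (hQ : DefPred L Q) :
    DefPred L (fun v => P v → Q v) :=
  (hP.not.or hQ).congr fun _ => by tauto

theorem DefPred.iff {P Q : (α → R) → Prop} (hP : DefPred L P) (hQ : DefPred L Q) :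
    DefPred L (fun v => P v ↔ Q v) :=
  ((hP.imp hQ).and (hQ.imp hP)).congr fun _ => by tauto

/-- The bound variable becomes the coordinate `none`, so that definability goals can be solved by
recursion on the shape of the formula. -/
theorem DefPred.ex {P : (α → R) → R → Prop}
    (h : DefPred L (fun w : Option α → R => P (fun i => w (some i)) (w none))) :
    DefPred L (fun v => ∃ x, P v x) := by
  have h1 : (Set.univ : Set R).Definable L
      {w : α ⊕ Unit → R | P (fun i => w (Sum.inl i)) (w (Sum.inr ()))} :=
    Set.Definable.preimage_comp (fun o : Option α => o.elim (Sum.inr ()) Sum.inl) h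
  have h2 := h1.exists_of_finite
  unfold DefPred
  convert! h2 using 1
  ext v
  constructor
  · rintro ⟨x, hx⟩
    exact ⟨fun _ => x, hx⟩
  · rintro ⟨x, hx⟩
    exact ⟨x (), hx⟩

theorem DefPred.all {P : (α → R) → R → Prop}
    (h : DefPred L (fun w : Option α → R => P (fun i => w (some i)) (w none))) :
    DefPred L (fun v => ∀ x, P v x) :=
  (DefPred.ex (P := fun v x => ¬ P v x) h.not).not.congr fun _ => by simp

theorem DefPred.eq {f g : (α → R) → R} (hf : DefTerm L f) (hg : DefTerm L g) :
    DefPred L (fun v => f v = g v) :=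
  Set.DefinableFun.ofPred_eq hf hg

theorem DefPred.mem {D : Set R} (hD : (Set.univ : Set R).Definable₁ L D) {f : (α → R) → R}
    (hf : DefTerm L f) : DefPred L (fun v => f v ∈ D) :=
  Set.Definable.preimage_map (F := fun v (_ : Fin 1) => f v) (fun _ => hf) hD

theorem DefPred.definable₁ {P : R → Prop} (h : DefPred L (fun v : Fin 1 → R => P (v 0))) :
    (Set.univ : Set R).Definable₁ L {x | P x} := h

variable [AddCommGroup R] [LinearOrder R]

theorem DefTerm.add (h : ExpandsOAG L R) {f g : (α → R) → R} (hf : DefTerm L f)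
    (hg : DefTerm L g) : DefTerm L (fun v => f v + g v) := by
  obtain ⟨F, hF⟩ := h.1
  have h1 : (Set.univ : Set R).DefinableFun L
      (fun v : α → R => Language.Structure.funMap F (![f v, g v])) := by
    refine Set.DefinableFun.comp (g := fun v => ![f v, g v]) (fun i => ?_)
      (Set.DefinableFun.of_empty (Set.DefinableFun.fun_symbol F))
    fin_cases i
    · exact hf
    · exact hg
  simpa [hF] using! h1

theorem DefPred.lt (h : ExpandsOAG L R) {f g : (α → R) → R} (hf : DefTerm L f)
    (hg : DefTerm L g) : DefPred L (fun v => f v < g v) := by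
  obtain ⟨r, hr⟩ := h.2
  have h0 : (Set.univ : Set R).Definable L {x : Fin 2 → R | x 0 < x 1} := by
    refine Set.Definable.mono (A := ∅) (Set.empty_definable_iff.2
      ⟨r.formula (fun i : Fin 2 => Language.Term.var i), ?_⟩) (Set.empty_subset _)
    ext x
    have := hr (x 0) (x 1)
    rw [show ![x 0, x 1] = x by ext i; fin_cases i <;> rfl] at this
    simp [Language.Formula.realize_rel, ← this]
  refine Set.Definable.preimage_map (F := fun v => ![f v, g v]) (fun i => ?_) h0
  fin_cases i
  · exact hf
  · exact hg

theorem DefPred.le (h : ExpandsOAG L R) {f g : (α → R) → R} (hf : DefTerm L f)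
    (hg : DefTerm L g) : DefPred L (fun v => f v ≤ g v) :=
  (DefPred.lt h hg hf).not.congr fun _ => by simp

end Definability

/-! ### From burden in all models to uniform finite bounds in `R`. -/

section Transfer

variable {L : FirstOrder.Language.{u, v}}

/-- Transport of an inp-pattern along an isomorphism. -/
def InpPattern.map {M : Type*} {N : Type*} [L.Structure M] [L.Structure N] {ι : Type}
    (p : InpPattern L M ι) (e : M ≃[L] N) : InpPattern L N ι where
  arity := p.arity
  formula := p.formula
  k := p.k
  k_pos := p.k_pos
  param i j t := e (p.param i j t)
  row_inconsistent i s hs := by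
    rintro ⟨x, hx⟩
    refine p.row_inconsistent i s hs ⟨e.symm x, fun j hj => ?_⟩
    rw [← Language.StrongHomClass.realize_formula e]
    convert hx j hj using 1
    ext t
    cases t <;> simp
  path_consistent η s := by
    obtain ⟨x, hx⟩ := p.path_consistent η s
    refine ⟨e x, fun i hi => ?_⟩
    have := hx i hi
    rw [← Language.StrongHomClass.realize_formula e] at this
    convert this using 1
    ext t
    cases t <;> simp

/-- Formulas of an inp-pattern carry no hidden parameters. A definition uses only finitely many
constants, and these are prepended to every parameter tuple. -/
theorem exists_formula_of_definable {R : Type w} [L.Structure R] {k : ℕ}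
    {S : R → (Fin k → R) → Prop}
    (hS : DefPred L (fun v : Option (Fin k) → R => S (v none) (fun j => v (some j)))) :
    ∃ (m : ℕ) (φ : L.Formula (Unit ⊕ Fin m)) (c : (Fin k → R) → Fin m → R),
      ∀ x y, S x y ↔ φ.Realize (Sum.elim (fun _ => x) (c y)) := by
  obtain ⟨A, -, hA⟩ := Set.definable_iff_finitely_definable.1 hS
  obtain ⟨φ, hφ⟩ := Set.definable_iff_exists_formula_sum.1 hA
  let e : (A : Set R) ≃ Fin A.card := A.equivFin
  let g : (A : Set R) ⊕ Option (Fin k) → Unit ⊕ Fin (A.card + k) :=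
    Sum.elim (fun a => Sum.inr (Fin.castAdd k (e a)))
      (fun o => o.elim (Sum.inl ()) (fun j => Sum.inr (Fin.natAdd _ j)))
  refine ⟨A.card + k, φ.relabel g, fun y => Fin.append (fun i => (e.symm i : R)) y, fun x y => ?_⟩
  have h := Set.ext_iff.1 hφ (fun o => o.elim x y)
  rw [Language.Formula.realize_relabel]
  refine Iff.trans ?_ (h.trans ?_)
  · exact Iff.rfl
  · apply iff_of_eq
    change φ.Realize _ = φ.Realize _
    congr 1
    ext t
    rcases t with a | _ | j <;> simp [g]

/-- If no model of the theory of `R` has an inp-pattern of depth `3`, then the depth-`3` finite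
patterns in `R` of a fixed definable shape have bounded length. -/
theorem exists_bound_of_burdenLT {R : Type w} [L.Structure R] [Nonempty R]
    (h : BurdenLT.{u, v, w} (L.completeTheory R) 3) {k : ℕ}
    (S : Fin 3 → R → (Fin k → R) → Prop)
    (hS : ∀ i, DefPred L (fun v : Option (Fin k) → R => S i (v none) (fun j => v (some j)))) :
    ∃ N : ℕ, ∀ p : Fin 3 → ℕ → Fin k → R,
      (∀ i, ∀ j < N, ∀ j' < N, j ≠ j' → ∀ x, S i x (p i j) → ¬ S i x (p i j')) →
      (∀ η : Fin 3 → ℕ, (∀ i, η i < N) → ∃ x, ∀ i, S i x (p i (η i))) → False := by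
  by_contra! hcon
  choose p hp₁ hp₂ using hcon
  choose m φ c hφ using fun i => exists_formula_of_definable (hS i)
  -- The `N`-th counterexample is correct on indices below `N`. For a nonprincipal ultrafilter any
  -- given finite set of indices is below almost every `N`, so the ultraproduct carries an infinite
  -- pattern.
  let U : Ultrafilter ℕ := hyperfilter ℕ
  let M : Type w := (U : Filter ℕ).Product (fun _ => R)
  have hT : M ⊨ L.completeTheory R := by
    refine ⟨fun ψ hψ => ?_⟩
    rw [Language.Ultraproduct.sentence_realize]
    exact Eventually.of_forall fun _ => hψ
  have hlarge : ∀ N : ℕ, ∀ᶠ n in (U : Filter ℕ), N < n := fun N =>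
    hyperfilter_le_cofinite.trans Nat.cofinite_eq_atTop.le (eventually_gt_atTop N)
  have hreal : ∀ (i : Fin 3) (j : ℕ) (x : ℕ → R),
      (φ i).Realize (Sum.elim (fun _ => ((x : (U : Filter ℕ).Product (fun _ => R)) : M))
        (fun t => (((fun n => c i (p n i j) t) : (U : Filter ℕ).Product (fun _ => R)) : M))) ↔
      ∀ᶠ n in (U : Filter ℕ), S i (x n) (p n i j) := by
    intro i j x
    simp only [hφ]
    let X : Unit ⊕ Fin (m i) → ℕ → R := Sum.elim (fun _ => x) (fun t n => c i (p n i j) t)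
    have h3 := Language.Ultraproduct.realize_formula_cast (u := U) (M := fun _ => R) (φ i) X
    refine Iff.trans (iff_of_eq ?_) (h3.trans (iff_of_eq ?_))
    · congr 1
      ext t
      cases t <;> rfl
    · congr 1
      ext n
      apply iff_of_eq
      congr 1
      ext t
      cases t <;> rfl
  let pat : InpPattern L M (Fin 3) :=
    { arity := m
      formula := φ
      k := fun _ => 2
      k_pos := fun _ => two_pos
      param := fun i j t => ((fun n => c i (p n i j) t) : (U : Filter ℕ).Product (fun _ => R))
      row_inconsistent := by
        rintro i s hs ⟨x, hx⟩
        obtain ⟨x, rfl⟩ := Quotient.exists_rep x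
        obtain ⟨j, j', hne, rfl⟩ := Finset.card_eq_two.1 hs
        have h1 := (hreal i j x).1 (hx j (by simp))
        have h2 := (hreal i j' x).1 (hx j' (by simp))
        obtain ⟨n, h1, h2, h3, h4⟩ :=
          (h1.and (h2.and ((hlarge j).and (hlarge j')))).exists
        exact hp₁ n i j h3 j' h4 hne _ h1 h2
      path_consistent := by
        intro η s
        have hx : ∀ n, ∃ x, (∀ i, η i < n) → ∀ i, S i x (p n i (η i)) := fun n => by
          by_cases hn : ∀ i, η i < n
          · obtain ⟨x, hx⟩ := (hp₂ n).1 η hn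
            exact ⟨x, fun _ => hx⟩
          · exact ⟨Classical.arbitrary R, fun h => absurd h hn⟩
        choose x hx using hx
        refine ⟨(x : (U : Filter ℕ).Product (fun _ => R)), fun i _ => (hreal i (η i) x).2 ?_⟩
        have : ∀ᶠ n in (U : Filter ℕ), ∀ i, η i < n := eventually_all.2 fun i => hlarge (η i)
        filter_upwards [this] with n hn using hx n hn i }
  have : Nonempty M := Language.Ultraproduct.Product.instNonempty
  let M₀ : Language.Theory.ModelType.{u, v, w} (L.completeTheory R) :=
    Language.Theory.ModelType.of _ M
  exact (h (Language.Theory.ModelType.ulift.{u, v, w, max u v w} M₀) (Fin 3) (by simp)).false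
    (pat.map (Equiv.inducedStructureEquiv (L := L) (Equiv.ulift.{max u v w, w}.symm : M ≃ _)))

theorem burdenLT_three {T : L.Theory} (h : HasBurden.{u, v, w} T 2) :
    BurdenLT.{u, v, w} T 3 := by
  have h3 : Order.succ (2 : Cardinal.{0}) = 3 := by
    have := Cardinal.succ_natCast 2
    norm_num at this
    exact this
  have := h.1
  rwa [h3] at this

end Transfer

/-! ### Three-digit patterns built from two scales. -/

section BoundedPatterns

variable {L : FirstOrder.Language.{u, v}} {R : Type w} [L.Structure R]

theorem exists_bound_three_rows [Nonempty R] (h : BurdenLT.{u, v, w} (L.completeTheory R) 3) {k : ℕ}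
    {S₀ S₁ S₂ : R → (Fin k → R) → Prop}
    (h₀ : DefPred L (fun v : Option (Fin k) → R => S₀ (v none) (fun j => v (some j))))
    (h₁ : DefPred L (fun v : Option (Fin k) → R => S₁ (v none) (fun j => v (some j))))
    (h₂ : DefPred L (fun v : Option (Fin k) → R => S₂ (v none) (fun j => v (some j)))) :
    ∃ N : ℕ, ∀ p₀ p₁ p₂ : ℕ → Fin k → R,
      (∀ j < N, ∀ j' < N, j ≠ j' → ∀ x, S₀ x (p₀ j) → ¬ S₀ x (p₀ j')) →
      (∀ j < N, ∀ j' < N, j ≠ j' → ∀ x, S₁ x (p₁ j) → ¬ S₁ x (p₁ j')) →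
      (∀ j < N, ∀ j' < N, j ≠ j' → ∀ x, S₂ x (p₂ j) → ¬ S₂ x (p₂ j')) →
      (∀ a < N, ∀ b < N, ∀ c < N, ∃ x, S₀ x (p₀ a) ∧ S₁ x (p₁ b) ∧ S₂ x (p₂ c)) → False := by
  obtain ⟨N, hN⟩ := exists_bound_of_burdenLT h ![S₀, S₁, S₂] (by
    intro i
    fin_cases i
    exacts [h₀, h₁, h₂])
  refine ⟨N, fun p₀ p₁ p₂ i₀ i₁ i₂ hc => hN ![p₀, p₁, p₂] ?_ ?_⟩
  · intro i
    fin_cases i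
    exacts [i₀, i₁, i₂]
  · intro η hη
    obtain ⟨x, hx₀, hx₁, hx₂⟩ := hc _ (hη 0) _ (hη 1) _ (hη 2)
    refine ⟨x, fun i => ?_⟩
    fin_cases i
    exacts [hx₀, hx₁, hx₂]

theorem DefPred.comp₃ {α : Type*} {E : R → R → R → Prop}
    (hE : DefPred L (fun v : Fin 3 → R => E (v 0) (v 1) (v 2))) {f g k : (α → R) → R}
    (hf : DefTerm L f) (hg : DefTerm L g) (hk : DefTerm L k) :
    DefPred L (fun v => E (f v) (g v) (k v)) := by
  refine Set.Definable.preimage_map (F := fun v => ![f v, g v, k v]) (fun i => ?_) hE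
  fin_cases i
  exacts [hf, hg, hk]

variable [AddCommGroup R] [LinearOrder R]

/-- A point of `{x | X x}` with no further point at distance less than `r` on its right. -/
def RightIsolated (X : R → Prop) (r d : R) : Prop := X d ∧ ∀ z, X z → d < z → d + r ≤ z

/-- The cells `[d, d + r)` over isolated points are disjoint, so `x` determines its cell. This makes
the digits well defined and the rows inconsistent. -/
theorem RightIsolated.unique {X : R → Prop} {r d d' x : R} (hd : RightIsolated X r d)
    (hd' : RightIsolated X r d') (h₁ : d ≤ x) (h₂ : x < d + r) (h₁' : d' ≤ x)
    (h₂' : x < d' + r) : d = d' := by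
  rcases lt_trichotomy d d' with h | h | h
  · exact absurd (hd.2 _ hd'.1 h) (not_le.2 (h₁'.trans_lt h₂))
  · exact h
  · exact absurd (hd'.2 _ hd.1 h) (not_le.2 (h₁.trans_lt h₂'))

variable [IsOrderedAddMonoid R]

theorem nsmul_interval_unique {g x y : R} (hg : 0 < g) {j j' : ℕ}
    (h₁ : y + j • g ≤ x) (h₂ : x < y + (j + 1) • g) (h₁' : y + j' • g ≤ x)
    (h₂' : x < y + (j' + 1) • g) : j = j' := by
  have h := h₁.trans_lt h₂'
  have h' := h₁'.trans_lt h₂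
  rw [add_lt_add_iff_left, nsmul_lt_nsmul_iff_left hg] at h h'
  omega

/-- In burden at most `2`, a definable set cannot have many points with a gap `r` on their right
while another definable set has many points in `[0, r)` with a smaller gap on their right. -/
theorem exists_bound_two_scales (hexp : ExpandsOAG L R)
    (hdiv : ∀ (g : R) (n : ℕ), 0 < n → ∃ h : R, n • h = g)
    (hB : BurdenLT.{u, v, w} (L.completeTheory R) 3)
    {D : Set R} (hD : (Set.univ : Set R).Definable₁ L D) {E : R → R → R → Prop}
    (hE : DefPred L (fun v : Fin 3 → R => E (v 0) (v 1) (v 2))) :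
    ∃ N : ℕ, ∀ (q q' r s : R) (A B : ℕ → R), 0 < s →
      (∀ j < N, RightIsolated (· ∈ D) r (A j)) →
      (∀ j < N, RightIsolated (E q q') s (B j) ∧ 0 ≤ B j ∧ B j + s ≤ r) →
      (∀ j < N, ∀ j' < N, A j = A j' → j = j') →
      (∀ j < N, ∀ j' < N, B j = B j' → j = j') → False := by
  -- Only `y 0` and `y 1` vary along a row; `y 2, …, y 5` hold `q, q', r, s`. The rows fix the
  -- coarse cell, the fine cell relative to it, and the offset in the fine cell.
  obtain ⟨N, hN⟩ := exists_bound_three_rows hB (k := 6)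
    (S₀ := fun x y => y 0 ≤ x ∧ x < y 0 + y 4)
    (S₁ := fun x y => ∃ d, (d ∈ D ∧ ∀ z, z ∈ D → d < z → d + y 4 ≤ z) ∧ d ≤ x ∧ x < d + y 4 ∧
      d + y 0 ≤ x ∧ x < d + y 0 + y 5)
    (S₂ := fun x y => ∃ d, (d ∈ D ∧ ∀ z, z ∈ D → d < z → d + y 4 ≤ z) ∧ d ≤ x ∧ x < d + y 4 ∧
      ∃ e, (E (y 2) (y 3) e ∧ ∀ z, E (y 2) (y 3) z → e < z → e + y 5 ≤ z) ∧
        d + e ≤ x ∧ x < d + e + y 5 ∧ d + e + y 0 ≤ x ∧ x < d + e + y 1)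
    (by repeat' first
          | apply DefPred.and | apply DefPred.imp | apply DefPred.ex | apply DefPred.all
          | apply DefPred.mem hD | apply DefPred.le hexp | apply DefPred.lt hexp
          | apply DefPred.comp₃ hE | apply DefTerm.proj | apply DefTerm.add hexp)
    (by repeat' first
          | apply DefPred.and | apply DefPred.imp | apply DefPred.ex | apply DefPred.all
          | apply DefPred.mem hD | apply DefPred.le hexp | apply DefPred.lt hexp
          | apply DefPred.comp₃ hE | apply DefTerm.proj | apply DefTerm.add hexp)
    (by repeat' first
          | apply DefPred.and | apply DefPred.imp | apply DefPred.ex | apply DefPred.all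
          | apply DefPred.mem hD | apply DefPred.le hexp | apply DefPred.lt hexp
          | apply DefPred.comp₃ hE | apply DefTerm.proj | apply DefTerm.add hexp)
  refine ⟨N, fun q q' r s A B hs hA hB' hAinj hBinj => ?_⟩
  -- Steps of size `g = s / (N + 1)` make room for `N` disjoint offsets within a fine cell. The path
  -- `(a, b, c)` is realised by `A a + B b + c • g`.
  obtain ⟨g, hg⟩ := hdiv s (N + 1) N.succ_pos
  have hg0 : 0 < g := by
    rw [← hg] at hs
    exact (nsmul_pos_iff N.succ_ne_zero).1 hs
  refine hN (fun j => ![A j, 0, q, q', r, s]) (fun j => ![B j, 0, q, q', r, s])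
    (fun j => ![j • g, (j + 1) • g, q, q', r, s]) ?_ ?_ ?_ ?_
  · rintro j hj j' hj' hne x ⟨h₁, h₂⟩ ⟨h₁', h₂'⟩
    exact hne (hAinj j hj j' hj' ((hA j hj).unique (hA j' hj') h₁ h₂ h₁' h₂'))
  · rintro j hj j' hj' hne x ⟨d, hd, h₁, h₂, h₃, h₄⟩ ⟨d', hd', h₁', h₂', h₃', h₄'⟩
    obtain rfl := RightIsolated.unique (X := (· ∈ D)) hd hd' h₁ h₂ h₁' h₂'
    refine hne (hBinj j hj j' hj' ((hB' j hj).1.unique (hB' j' hj').1 (x := x - d) ?_ ?_ ?_ ?_))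
    · exact le_sub_iff_add_le'.2 h₃
    · exact sub_lt_iff_lt_add'.2 (by rw [← add_assoc]; exact h₄)
    · exact le_sub_iff_add_le'.2 h₃'
    · exact sub_lt_iff_lt_add'.2 (by rw [← add_assoc]; exact h₄')
  · rintro j hj j' hj' hne x ⟨d, hd, h₁, h₂, e, he, h₃, h₄, h₅, h₆⟩
      ⟨d', hd', h₁', h₂', e', he', h₃', h₄', h₅', h₆'⟩
    obtain rfl := RightIsolated.unique (X := (· ∈ D)) hd hd' h₁ h₂ h₁' h₂'
    obtain rfl : e = e' := by
      refine RightIsolated.unique (X := E q q') he he' (x := x - d) ?_ ?_ ?_ ?_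
      · exact le_sub_iff_add_le'.2 h₃
      · exact sub_lt_iff_lt_add'.2 (by rw [← add_assoc]; exact h₄)
      · exact le_sub_iff_add_le'.2 h₃'
      · exact sub_lt_iff_lt_add'.2 (by rw [← add_assoc]; exact h₄')
    exact hne (nsmul_interval_unique hg0 h₅ h₆ h₅' h₆')
  · intro a ha b hb c hc
    have hc0 : 0 ≤ c • g := nsmul_nonneg hg0.le c
    have hcs : c • g < s := by
      rw [← hg, nsmul_lt_nsmul_iff_left hg0]
      omega
    have hcc : c • g < (c + 1) • g := by
      rw [nsmul_lt_nsmul_iff_left hg0]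
      omega
    have hb0 := (hB' b hb).2.1
    have h1 : A a ≤ A a + B b := le_add_of_nonneg_right hb0
    have h2 : A a + B b ≤ A a + B b + c • g := le_add_of_nonneg_right hc0
    have h3 : A a + B b + c • g < A a + B b + s := by gcongr
    have h4 : A a + B b + s ≤ A a + r := by
      rw [add_assoc]
      gcongr
      exact (hB' b hb).2.2
    refine ⟨A a + B b + c • g, ⟨h1.trans h2, h3.trans_le h4⟩,
      ⟨A a, hA a ha, h1.trans h2, h3.trans_le h4, h2, h3⟩,
      ⟨A a, hA a ha, h1.trans h2, h3.trans_le h4, B b, (hB' b hb).1, h2, h3, le_rfl, ?_⟩⟩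
    change A a + B b + c • g < A a + B b + (c + 1) • g
    gcongr

end BoundedPatterns

/-! ### Isolated points near an accumulation point, and separation of sets. -/

section Separation

variable {R : Type w} [AddCommGroup R] [LinearOrder R] [IsOrderedAddMonoid R]

theorem exists_gap_of_isDiscrete [TopologicalSpace R] [OrderTopology R] [Nontrivial R] {D : Set R}
    (hdisc : IsDiscrete D) {d : R} (hd : d ∈ D) :
    ∃ ε > 0, ∀ x ∈ D, |x - d| < ε → x = d := by
  obtain ⟨u, hu, hud⟩ := isDiscrete_iff_forall_mem_exists_isOpen.1 hdisc d hd
  have hdu : d ∈ u := (hud.symm.subset (Set.mem_singleton d)).1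
  obtain ⟨ε, hε, h⟩ := (nhds_basis_abs_sub_lt d).mem_iff.1 (hu.mem_nhds hdu)
  exact ⟨ε, hε, fun x hx hxd => hud.subset ⟨h hxd, hx⟩⟩

/-- Points of `D` are chosen ever closer to `p`; the common radius is a minimum of finitely many,
which is why only the first `N` are controlled. -/
theorem exists_rightIsolated_sequence {D : Set R}
    (hdisc : ∀ d ∈ D, ∃ ε > 0, ∀ x ∈ D, d < x → d + ε ≤ x) {p : R}
    (hp : ∀ ε > 0, ∃ x ∈ D, p < x ∧ x < p + ε) (N : ℕ) {ε : R} (hε : 0 < ε) :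
    ∃ A : ℕ → R, (∀ j j', A j = A j' → j = j') ∧ (∀ j, p < A j ∧ A j < p + ε) ∧
      ∃ r > 0, r ≤ ε ∧ ∀ j < N, RightIsolated (· ∈ D) r (A j) := by
  have hp' : ∀ y : Set.Ioi p, ∃ x : Set.Ioi p, (x : R) ∈ D ∧ x < y := by
    rintro ⟨y, hy⟩
    obtain ⟨x, hx, h₁, h₂⟩ := hp (y - p) (sub_pos.2 hy)
    exact ⟨⟨x, h₁⟩, hx, Subtype.coe_lt_coe.1 (by simpa using h₂)⟩
  choose f hfD hf using hp'
  let A : ℕ → Set.Ioi p := fun n => f^[n + 1] ⟨p + ε, by simpa using hε⟩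
  have hA : ∀ n, A (n + 1) = f (A n) := fun n => Function.iterate_succ_apply' _ _ _
  have hAD : ∀ n, (A n : R) ∈ D := by
    rintro (_ | n)
    · exact hfD _
    · rw [hA]
      exact hfD _
  have hanti : StrictAnti A := strictAnti_nat_of_succ_lt fun n => by
    rw [hA]
    exact hf _
  have hr : ∀ N : ℕ, ∃ r > 0, r ≤ ε ∧ ∀ j < N, RightIsolated (· ∈ D) r (A j : R) := by
    intro N
    induction N with
    | zero => exact ⟨ε, hε, le_rfl, by simp⟩
    | succ N ih =>
      obtain ⟨r, hr0, hr, h⟩ := ih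
      obtain ⟨r', hr'0, h'⟩ := hdisc _ (hAD N)
      refine ⟨min r r', lt_min hr0 hr'0, (min_le_left _ _).trans hr, fun j hj => ⟨hAD j, ?_⟩⟩
      intro z hz hjz
      rcases Nat.lt_succ_iff_lt_or_eq.1 hj with hj | rfl
      · exact (add_le_add_right (min_le_left _ _) _).trans ((h j hj).2 z hz hjz)
      · exact (add_le_add_right (min_le_right _ _) _).trans (h' z hz hjz)
  refine ⟨fun n => A n, fun j j' h => hanti.injective (Subtype.ext h), fun j => ⟨(A j).2, ?_⟩, hr N⟩
  have h0 : A 0 < ⟨p + ε, by simpa using hε⟩ := hf _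
  have : A j < ⟨p + ε, by simpa using hε⟩ := (hanti.antitone (Nat.zero_le j)).trans_lt h0
  exact this

/-- At most one point of an `s`-separated set lies within `s` of `e₀` on each side, so its distance
to `e₀`, or `s` if there is none, serves as the bound on that side. -/
theorem exists_separation_insert {F : R → Prop} {s e₀ : R} (hs : 0 < s)
    (hF : ∀ e e', F e → F e' → e < e' → e + s ≤ e') :
    ∃ t > 0, ∀ e e', (F e ∨ e = e₀) → (F e' ∨ e' = e₀) → e < e' → e + t ≤ e' := by
  have hr : ∃ t > 0, ∀ e, F e → e₀ < e → e₀ + t ≤ e := by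
    by_cases h : ∃ x, F x ∧ e₀ < x ∧ x < e₀ + s
    · obtain ⟨x, hx, h₁, h₂⟩ := h
      refine ⟨x - e₀, sub_pos.2 h₁, fun e he hee => ?_⟩
      rw [add_sub_cancel]
      by_contra! hlt
      have := (hF e x he hx hlt).trans_lt h₂
      exact absurd (lt_of_add_lt_add_right this) hee.not_gt
    · push Not at h
      exact ⟨s, hs, h⟩
  have hl : ∃ t > 0, ∀ e, F e → e < e₀ → e + t ≤ e₀ := by
    by_cases h : ∃ x, F x ∧ x < e₀ ∧ e₀ < x + s
    · obtain ⟨x, hx, h₁, h₂⟩ := h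
      refine ⟨e₀ - x, sub_pos.2 h₁, fun e he hee => ?_⟩
      have : e ≤ x := by
        by_contra! hlt
        have := (hF x e hx he hlt).trans_lt hee
        exact absurd h₂ this.not_gt
      calc e + (e₀ - x) ≤ x + (e₀ - x) := by gcongr
        _ = e₀ := by abel
    · push Not at h
      exact ⟨s, hs, h⟩
  obtain ⟨t₁, h₁, hr⟩ := hr
  obtain ⟨t₂, h₂, hl⟩ := hl
  refine ⟨min s (min t₁ t₂), by simp [*], ?_⟩
  rintro e e' (he | rfl) (he' | rfl) hee
  · exact (add_le_add_right (min_le_left _ _) _).trans (hF _ _ he he' hee)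
  · exact (add_le_add_right ((min_le_right _ _).trans (min_le_right _ _)) _).trans (hl _ he hee)
  · exact (add_le_add_right ((min_le_right _ _).trans (min_le_left _ _)) _).trans (hr _ he' hee)
  · exact absurd hee (lt_irrefl _)

end Separation

/-! ### Definable discrete sets do not accumulate. -/

section Closed

variable {L : FirstOrder.Language.{u, v}} {R : Type w} [L.Structure R]
  [AddCommGroup R] [LinearOrder R] [IsOrderedAddMonoid R]

/-- If `D` accumulated at `p` from the right, it would supply both scales: `N` points isolated at
scale `r`, then `N` points much closer to `p`, translated by `-p`. -/
theorem exists_right_gap (hexp : ExpandsOAG L R)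
    (hdiv : ∀ (g : R) (n : ℕ), 0 < n → ∃ h : R, n • h = g)
    (hB : BurdenLT.{u, v, w} (L.completeTheory R) 3) [Nontrivial R]
    {D : Set R} (hD : (Set.univ : Set R).Definable₁ L D)
    (hdisc : ∀ d ∈ D, ∃ ε > 0, ∀ x ∈ D, d < x → d + ε ≤ x) (p : R) :
    ∃ ε > 0, ∀ x ∈ D, p < x → p + ε ≤ x := by
  by_contra! hp
  -- The fine set is `D - p`; the second parameter of `E` is a dummy.
  obtain ⟨N, hN⟩ := exists_bound_two_scales hexp hdiv hB hD (E := fun q _ e => q + e ∈ D)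
    (DefPred.mem hD (DefTerm.add hexp (DefTerm.proj _) (DefTerm.proj _)))
  obtain ⟨ε, hε⟩ := exists_gt (0 : R)
  obtain ⟨A, hAinj, -, r, hr, -, hA⟩ := exists_rightIsolated_sequence hdisc hp N hε
  -- Half of `r` bounds the fine points and the other half bounds `s`, so the fine cells stay inside
  -- `[0, r)`.
  obtain ⟨h, rfl⟩ := hdiv r 2 two_pos
  have hh : 0 < h := (nsmul_pos_iff two_ne_zero).1 hr
  obtain ⟨B, hBinj, hBp, s, hs, hsh, hB⟩ := exists_rightIsolated_sequence hdisc hp N hh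
  refine hN p 0 (2 • h) s A (fun j => B j - p) hs hA ?_ (fun j _ j' _ => hAinj j j')
    (fun j _ j' _ e => hBinj j j' (by simpa using e))
  intro j hj
  refine ⟨⟨by simpa using (hB j hj).1, fun z hz hlt => ?_⟩, sub_nonneg.2 (hBp j).1.le, ?_⟩
  · have := (hB j hj).2 (p + z) hz (sub_lt_iff_lt_add'.1 hlt)
    rw [sub_add_eq_add_sub]
    exact sub_le_iff_le_add'.2 this
  · rw [two_nsmul]
    exact add_le_add (sub_le_iff_le_add'.2 (hBp j).2.le) hsh

theorem exists_left_gap (hexp : ExpandsOAG L R)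
    (hdiv : ∀ (g : R) (n : ℕ), 0 < n → ∃ h : R, n • h = g)
    (hB : BurdenLT.{u, v, w} (L.completeTheory R) 3) [Nontrivial R]
    {D : Set R} (hD : (Set.univ : Set R).Definable₁ L D)
    (hdisc : ∀ d ∈ D, ∃ ε > 0, ∀ x ∈ D, x < d → x + ε ≤ d) (p : R) :
    ∃ ε > 0, ∀ x ∈ D, x < p → x + ε ≤ p := by
  have hD' : (Set.univ : Set R).Definable₁ L {x | -x ∈ D} := by
    refine DefPred.definable₁ (DefPred.congr (P := fun v => ∃ y, y ∈ D ∧ v 0 + y = 0) ?_ ?_)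
    · apply DefPred.ex
      exact (DefPred.mem hD (DefTerm.proj _)).and
        (DefPred.eq (DefTerm.add hexp (DefTerm.proj _) (DefTerm.proj _)) (DefTerm.const _))
    · intro v
      constructor
      · exact fun h => ⟨_, h, by simp⟩
      · rintro ⟨y, hy, h⟩
        rwa [neg_eq_of_add_eq_zero_right h]
  obtain ⟨ε, hε, h⟩ := exists_right_gap hexp hdiv hB hD' (fun d hd => by
    obtain ⟨ε, hε, h⟩ := hdisc _ hd
    refine ⟨ε, hε, fun x hx hdx => ?_⟩
    have := h _ hx (neg_lt_neg hdx)
    convert add_le_add_right this (x + d) using 1 <;> abel) (-p)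
  refine ⟨ε, hε, fun x hx hxp => ?_⟩
  have := h (-x) (by simpa using hx) (neg_lt_neg hxp)
  convert add_le_add_right this (x + p) using 1 <;> abel

variable (L) in
/-- Nonempty definable subsets of `D` that are bounded have a least and a greatest element. -/
structure DefWellOrdered (D : Set R) : Prop where
  exists_isLeast : ∀ X : Set R, X ⊆ D → (Set.univ : Set R).Definable₁ L X → X.Nonempty →
    BddBelow X → ∃ b, IsLeast X b
  exists_isGreatest : ∀ X : Set R, X ⊆ D → (Set.univ : Set R).Definable₁ L X → X.Nonempty →
    BddAbove X → ∃ b, IsGreatest X b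

/-- An infimum or supremum that is not attained could be improved by the gap `ε` next to it. The
gaps are therefore needed at every point of `R`, not only at points of `D`. -/
theorem defWellOrdered_of_gaps (hexp : ExpandsOAG L R) (hcomplete : DefinablyComplete L R)
    {D : Set R} (hr : ∀ p, ∃ ε > 0, ∀ x ∈ D, p < x → p + ε ≤ x)
    (hl : ∀ p, ∃ ε > 0, ∀ x ∈ D, x < p → x + ε ≤ p) : DefWellOrdered L D where
  exists_isLeast X hXD hX hne hbdd := by
    obtain ⟨c, hc⟩ := hcomplete {y | ∀ x, x ∈ X → y ≤ x} (by
      refine DefPred.definable₁ ?_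
      apply DefPred.all
      exact (DefPred.mem hX (DefTerm.proj _)).imp (DefPred.le hexp (DefTerm.proj _)
        (DefTerm.proj _))) (by
        obtain ⟨b, hb⟩ := hbdd
        exact ⟨b, fun x hx => hb hx⟩) (by
        obtain ⟨x, hx⟩ := hne
        exact ⟨x, fun y hy => hy x hx⟩)
    have hcX : ∀ x ∈ X, c ≤ x := fun x hx => hc.2 fun y hy => hy x hx
    refine ⟨c, ?_, fun x hx => hcX x hx⟩
    by_contra hcX'
    obtain ⟨ε, hε, h⟩ := hr c
    have : c + ε ≤ c := hc.1 fun x hx => h x (hXD hx)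
      ((hcX x hx).lt_of_ne fun h => hcX' (h ▸ hx))
    exact absurd this (by simpa using hε)
  exists_isGreatest X hXD hX hne hbdd := by
    obtain ⟨c, hc⟩ := hcomplete X hX hne hbdd
    refine ⟨c, ?_, hc.1⟩
    by_contra hcX'
    obtain ⟨ε, hε, h⟩ := hl c
    have : c ≤ c - ε := hc.2 fun x hx => le_sub_iff_add_le.2 (h x (hXD hx)
      ((hc.1 hx).lt_of_ne fun h => hcX' (h ▸ hx)))
    exact absurd this (by simpa using hε)

theorem defWellOrdered_of_isDiscrete [TopologicalSpace R] [OrderTopology R]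
    (hexp : ExpandsOAG L R) (hdiv : ∀ (g : R) (n : ℕ), 0 < n → ∃ h : R, n • h = g)
    (hcomplete : DefinablyComplete L R) (hB : BurdenLT.{u, v, w} (L.completeTheory R) 3)
    {D : Set R} (hD : (Set.univ : Set R).Definable₁ L D) (hdisc : IsDiscrete D) :
    DefWellOrdered L D := by
  rcases subsingleton_or_nontrivial R with _ | _
  · exact ⟨fun X _ _ ⟨x, hx⟩ _ => ⟨x, hx, fun y _ => (Subsingleton.elim x y).le⟩,
      fun X _ _ ⟨x, hx⟩ _ => ⟨x, hx, fun y _ => (Subsingleton.elim y x).le⟩⟩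
  · refine defWellOrdered_of_gaps hexp hcomplete
      (exists_right_gap hexp hdiv hB hD fun d hd => ?_)
      (exists_left_gap hexp hdiv hB hD fun d hd => ?_)
    · obtain ⟨ε, hε, h⟩ := exists_gap_of_isDiscrete hdisc hd
      refine ⟨ε, hε, fun x hx hdx => ?_⟩
      by_contra! hlt
      refine hdx.ne' (h x hx ?_)
      rw [abs_of_pos (sub_pos.2 hdx)]
      exact sub_lt_iff_lt_add'.2 hlt
    · obtain ⟨ε, hε, h⟩ := exists_gap_of_isDiscrete hdisc hd
      refine ⟨ε, hε, fun x hx hdx => ?_⟩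
      by_contra! hlt
      refine hdx.ne (h x hx ?_)
      rw [abs_sub_comm, abs_of_pos (sub_pos.2 hdx)]
      exact sub_lt_iff_lt_add'.2 hlt

end Closed

/-! ### Successor and predecessor in a subset of a linear order. -/

section Successors

variable {R : Type w} [LinearOrder R]

theorem isLeast_succIn {D : Set R} {a : R} (h : ∃ b, IsLeast {b | b ∈ D ∧ a < b} b) :
    IsLeast {b | b ∈ D ∧ a < b} (succIn D a) := by
  rw [succIn, dif_pos h]
  exact h.choose_spec

theorem IsLeast.succIn_eq {D : Set R} {a b : R} (h : IsLeast {b | b ∈ D ∧ a < b} b) :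
    succIn D a = b :=
  (isLeast_succIn ⟨b, h⟩).unique h

theorem isLeast_succIn_of_ne {D : Set R} {a : R} (h : succIn D a ≠ a) :
    IsLeast {b | b ∈ D ∧ a < b} (succIn D a) := by
  refine isLeast_succIn ?_
  by_contra h'
  exact h (by rw [succIn, dif_neg h'])

theorem isGreatest_predIn {D : Set R} {a : R} (h : ∃ b, IsGreatest {b | b ∈ D ∧ b < a} b) :
    IsGreatest {b | b ∈ D ∧ b < a} (predIn D a) := by
  rw [predIn, dif_pos h]
  exact h.choose_spec

theorem isGreatest_predIn_of_ne {D : Set R} {a : R} (h : predIn D a ≠ a) :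
    IsGreatest {b | b ∈ D ∧ b < a} (predIn D a) := by
  refine isGreatest_predIn ?_
  by_contra h'
  exact h (by rw [predIn, dif_neg h'])

theorem succIn_mem {D : Set R} {a : R} (ha : a ∈ D) : succIn D a ∈ D := by
  by_cases h : succIn D a = a
  · rwa [h]
  · exact (isLeast_succIn_of_ne h).1.1

theorem predIn_mem {D : Set R} {a : R} (ha : a ∈ D) : predIn D a ∈ D := by
  by_cases h : predIn D a = a
  · rwa [h]
  · exact (isGreatest_predIn_of_ne h).1.1

theorem le_succIn (D : Set R) (a : R) : a ≤ succIn D a := by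
  by_cases h : succIn D a = a
  · exact h.ge
  · exact (isLeast_succIn_of_ne h).1.2.le

theorem predIn_le (D : Set R) (a : R) : predIn D a ≤ a := by
  by_cases h : predIn D a = a
  · exact h.le
  · exact (isGreatest_predIn_of_ne h).1.2.le

theorem succIn_predIn {D : Set R} {a : R} (ha : a ∈ D) (h : predIn D a ≠ a) :
    succIn D (predIn D a) = a := by
  have hp := isGreatest_predIn_of_ne h
  refine IsLeast.succIn_eq ⟨⟨ha, hp.1.2⟩, fun x hx => ?_⟩
  by_contra! hlt
  exact absurd (hp.2 ⟨hx.1, hlt⟩) (not_le.2 hx.2)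

end Successors

/-! ### Finiteness of the difference set. -/

section FiniteDifferences

variable {L : FirstOrder.Language.{u, v}} {R : Type w} [L.Structure R]
  [AddCommGroup R] [LinearOrder R]

theorem DefWellOrdered.isLeast_succIn (hexp : ExpandsOAG L R) {D : Set R}
    (hD : (Set.univ : Set R).Definable₁ L D) (h : DefWellOrdered L D) {a : R}
    (ha : ∃ b ∈ D, a < b) : IsLeast {b | b ∈ D ∧ a < b} (succIn D a) :=
  _root_.isLeast_succIn (h.exists_isLeast _ (fun _ hx => hx.1)
    (DefPred.definable₁ ((DefPred.mem hD (DefTerm.proj _)).and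
      (DefPred.lt hexp (DefTerm.const _) (DefTerm.proj _))))
    (by simpa [Set.Nonempty] using ha) ⟨a, fun _ hx => hx.2.le⟩)

theorem DefWellOrdered.isGreatest_predIn (hexp : ExpandsOAG L R) {D : Set R}
    (hD : (Set.univ : Set R).Definable₁ L D) (h : DefWellOrdered L D) {a : R}
    (ha : ∃ b ∈ D, b < a) : IsGreatest {b | b ∈ D ∧ b < a} (predIn D a) :=
  _root_.isGreatest_predIn (h.exists_isGreatest _ (fun _ hx => hx.1)
    (DefPred.definable₁ ((DefPred.mem hD (DefTerm.proj _)).and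
      (DefPred.lt hexp (DefTerm.proj _) (DefTerm.const _))))
    (by simpa [Set.Nonempty] using ha) ⟨a, fun _ hx => hx.2.le⟩)

/-- `e` is the difference between some `u ∈ D ∩ [q, q']` and its successor in `D`. -/
def IsGapOn (D : Set R) (q q' e : R) : Prop :=
  ∃ u, u ∈ D ∧ q ≤ u ∧ u ≤ q' ∧ u + e ∈ D ∧ 0 < e ∧ ∀ z, z ∈ D → u < z → u + e ≤ z

theorem defPred_isGapOn (hexp : ExpandsOAG L R) {D : Set R}
    (hD : (Set.univ : Set R).Definable₁ L D) :
    DefPred L (fun v : Fin 3 → R => IsGapOn D (v 0) (v 1) (v 2)) := by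
  unfold IsGapOn
  repeat' first
    | apply DefPred.and | apply DefPred.imp | apply DefPred.ex | apply DefPred.all
    | apply DefPred.mem hD | apply DefPred.le hexp | apply DefPred.lt hexp
    | apply DefTerm.proj | apply DefTerm.const | apply DefTerm.add hexp

variable [IsOrderedAddMonoid R]

/-- Definable induction on the right endpoint: at a least bad `d` the predecessor is good, and
passing to `d` adds at most one new difference, which cannot destroy separation. -/
theorem exists_separation_isGapOn [Nontrivial R] (hexp : ExpandsOAG L R) {D : Set R}
    (hD : (Set.univ : Set R).Definable₁ L D) (h : DefWellOrdered L D) (q : R) :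
    ∀ d ∈ D, ∃ s, 0 < s ∧ ∀ e e', IsGapOn D q d e → IsGapOn D q d e' → e < e' → e + s ≤ e' := by
  by_contra! hcon
  have hgap := defPred_isGapOn hexp hD
  obtain ⟨d, ⟨hd, hbad⟩, hmin⟩ := h.exists_isLeast
    {d | d ∈ D ∧ ¬ ∃ s, 0 < s ∧ ∀ e e', IsGapOn D q d e → IsGapOn D q d e' → e < e' → e + s ≤ e'}
    (fun _ hx => hx.1) (DefPred.definable₁ (by
      repeat' first
        | apply DefPred.and | apply DefPred.not | apply DefPred.imp | apply DefPred.ex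
        | apply DefPred.all | apply DefPred.mem hD | apply DefPred.comp₃ hgap
        | apply DefPred.le hexp | apply DefPred.lt hexp
        | apply DefTerm.proj | apply DefTerm.const | apply DefTerm.add hexp))
    (by
      obtain ⟨d, hd, h'⟩ := hcon
      refine ⟨d, hd, ?_⟩
      push Not
      exact h')
    -- For `d < q` there are no differences to separate, so bad points are bounded below by `q`.
    ⟨q, by
      rintro d ⟨hd, hbad⟩
      by_contra! hlt
      obtain ⟨ε, hε⟩ := exists_gt (0 : R)
      refine hbad ⟨ε, hε, ?_⟩
      rintro e e' ⟨u, -, h₁, h₂, -⟩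
      exact absurd (h₁.trans h₂) (not_le.2 hlt)⟩
  refine hbad ?_
  have huniq : ∀ u e e', (u + e ∈ D ∧ 0 < e ∧ ∀ z, z ∈ D → u < z → u + e ≤ z) →
      (u + e' ∈ D ∧ 0 < e' ∧ ∀ z, z ∈ D → u < z → u + e' ≤ z) → e = e' := by
    rintro u e e' ⟨h₁, h₂, h₃⟩ ⟨h₁', h₂', h₃'⟩
    exact le_antisymm (by simpa using h₃ _ h₁' (by simpa using h₂'))
      (by simpa using h₃' _ h₁ (by simpa using h₂))
  have hprev : ∃ F : R → Prop, (∀ u e, u ∈ D → q ≤ u → u < d →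
      (u + e ∈ D ∧ 0 < e ∧ ∀ z, z ∈ D → u < z → u + e ≤ z) → F e) ∧
      ∃ s, 0 < s ∧ ∀ e e', F e → F e' → e < e' → e + s ≤ e' := by
    by_cases hlow : ∃ b ∈ D, b < d
    · have hp := h.isGreatest_predIn hexp hD hlow
      refine ⟨IsGapOn D q (predIn D d), fun u e hu hqu hud he => ⟨u, hu, hqu, hp.2 ⟨hu, hud⟩, he⟩, ?_⟩
      by_contra hbad'
      exact absurd (hmin ⟨hp.1.1, hbad'⟩) (not_le.2 hp.1.2)
    · obtain ⟨ε, hε⟩ := exists_gt (0 : R)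
      exact ⟨fun _ => False, fun u e hu _ hud _ => hlow ⟨u, hu, hud⟩, ε, hε, fun _ _ hf => hf.elim⟩
  obtain ⟨F, hF, s, hs, hsep⟩ := hprev
  by_cases he₀ : ∃ e₀, d + e₀ ∈ D ∧ 0 < e₀ ∧ ∀ z, z ∈ D → d < z → d + e₀ ≤ z
  · obtain ⟨e₀, he₀⟩ := he₀
    obtain ⟨t, ht, hsep'⟩ := exists_separation_insert (e₀ := e₀) hs hsep
    have hin : ∀ e, IsGapOn D q d e → F e ∨ e = e₀ := by
      rintro e ⟨u, hu, hqu, hud, he⟩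
      rcases hud.lt_or_eq with hlt | rfl
      · exact Or.inl (hF u e hu hqu hlt he)
      · exact Or.inr (huniq u e e₀ he he₀)
    exact ⟨t, ht, fun e e' he he' => hsep' e e' (hin e he) (hin e' he')⟩
  · have hin : ∀ e, IsGapOn D q d e → F e := by
      rintro e ⟨u, hu, hqu, hud, he⟩
      rcases hud.lt_or_eq with hlt | rfl
      · exact hF u e hu hqu hlt he
      · exact absurd ⟨e, he⟩ he₀
    exact ⟨s, hs, fun e e' he he' => hsep e e' (hin e he) (hin e' he')⟩

/-- In burden at most `2`, a definable discrete set has finitely many differences. -/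
theorem finite_diffSet (hexp : ExpandsOAG L R)
    (hdiv : ∀ (g : R) (n : ℕ), 0 < n → ∃ h : R, n • h = g)
    (hB : BurdenLT.{u, v, w} (L.completeTheory R) 3)
    {D : Set R} (hD : (Set.univ : Set R).Definable₁ L D) (h : DefWellOrdered L D) :
    (diffSet D).Finite := by
  by_contra hinf
  obtain ⟨N, hN⟩ := exists_bound_two_scales hexp hdiv hB hD (defPred_isGapOn hexp hD)
  -- With the differences enumerated increasingly as `e`, take `r = e N`. Points followed by the
  -- gaps `e N, …, e (2N - 1)` are isolated at scale `r`, while `e 0, …, e (N - 1)` are fine points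
  -- in `[0, r)`.
  obtain ⟨F, hF, hcard⟩ := (Set.not_finite.1 hinf).exists_subset_card_eq (2 * N + 1)
  let e : Fin (2 * N + 1) ↪o R := F.orderEmbOfFin hcard
  have he : ∀ i, ∃ d ∈ D, d + e i ∈ D ∧ 0 < e i ∧ ∀ z, z ∈ D → d < z → d + e i ≤ z := by
    intro i
    obtain ⟨d, hd, hb, hgap⟩ := hF (F.orderEmbOfFin_mem hcard i)
    have hs := h.isLeast_succIn hexp hD hb
    have hde : d + e i = succIn D d := by
      change d + F.orderEmbOfFin hcard i = _
      rw [← hgap, gap, add_sub_cancel]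
    refine ⟨d, hd, hde ▸ hs.1.1, ?_, fun z hz hdz => hde ▸ hs.2 ⟨hz, hdz⟩⟩
    have := hs.1.2
    rw [← hde] at this
    simpa using this
  choose d hd hd' he0 hmin using he
  have hnt : Nontrivial R := ⟨⟨0, e 0, (he0 0).ne⟩⟩
  obtain ⟨q, hq⟩ := (Set.finite_range d).bddBelow
  obtain ⟨i', hi'⟩ := Finite.exists_max d
  obtain ⟨s, hs, hsep⟩ := exists_separation_isGapOn hexp hD h q (d i') (hd i')
  have hE : ∀ i, IsGapOn D q (d i') (e i) := fun i =>
    ⟨d i, hd i, hq ⟨i, rfl⟩, hi' i, hd' i, he0 i, hmin i⟩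
  let A : ℕ → R := fun j => if hj : N + j < 2 * N + 1 then d ⟨N + j, hj⟩ else 0
  let B : ℕ → R := fun j => if hj : j < 2 * N + 1 then e ⟨j, hj⟩ else 0
  have hA : ∀ j (hj : j < N), A j = d ⟨N + j, by omega⟩ := fun j hj => dif_pos (by omega)
  have hBe : ∀ j (hj : j < N), B j = e ⟨j, by omega⟩ := fun j hj => dif_pos (by omega)
  refine hN q (d i') (e ⟨N, by omega⟩) s A B hs ?_ ?_ ?_ ?_
  · intro j hj
    rw [hA j hj]
    refine ⟨hd _, fun z hz hlt => le_trans ?_ (hmin _ z hz hlt)⟩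
    exact add_le_add_right (e.monotone (by simp [Fin.le_def])) _
  · intro j hj
    rw [hBe j hj]
    exact ⟨⟨hE _, fun z hz hlt => hsep _ _ (hE _) hz hlt⟩, (he0 _).le,
      hsep _ _ (hE _) (hE _) (e.strictMono (by simpa [Fin.lt_def] using hj))⟩
  · intro j hj j' hj' heq
    rw [hA j hj, hA j' hj'] at heq
    -- Equal points have equal gaps, so distinct differences come from distinct points.
    have h₁ := hmin ⟨N + j, by omega⟩ _ (hd' ⟨N + j', by omega⟩)
      (by rw [heq]; simpa using he0 ⟨N + j', by omega⟩)
    have h₂ := hmin ⟨N + j', by omega⟩ _ (hd' ⟨N + j, by omega⟩)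
      (by rw [heq]; simpa using he0 ⟨N + j, by omega⟩)
    rw [heq] at h₁ h₂
    have := e.injective (le_antisymm (le_of_add_le_add_left h₁) (le_of_add_le_add_left h₂))
    simpa using this
  · intro j hj j' hj' heq
    rw [hBe j hj, hBe j' hj'] at heq
    simpa using e.injective heq

end FiniteDifferences

/-! ### Words of differences as local copies of `D`. -/

section Words

variable {R : Type w} [LinearOrder R]

theorem iterate_succIn_mem {D : Set R} {d : R} (hd : d ∈ D) (n : ℕ) : (succIn D)^[n] d ∈ D := by
  induction n with
  | zero => exact hd
  | succ n ih =>
    rw [Function.iterate_succ_apply']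
    exact succIn_mem ih

theorem monotone_iterate_succIn (D : Set R) (d : R) : Monotone fun n => (succIn D)^[n] d :=
  monotone_nat_of_le_succ fun n => by
    rw [Function.iterate_succ_apply']
    exact le_succIn _ _

variable [AddCommGroup R]

theorem iterate_sub_eq_of_mem_patternSet {D : Set R} {n : ℕ} {σ : Fin n → R} {d d' : R}
    (hd : d ∈ patternSet D σ) (hd' : d' ∈ patternSet D σ) {l : ℕ} (hl : l ≤ n) :
    (succIn D)^[l] d - d = (succIn D)^[l] d' - d' := by
  induction l with
  | zero => simp
  | succ l ih =>
    have h := hd.2 ⟨l, hl⟩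
    have h' := hd'.2 ⟨l, hl⟩
    have ih := ih (by omega)
    rw [Function.iterate_succ_apply', Function.iterate_succ_apply']
    have e : ∀ x y : R, succIn D y - x = gap D y + (y - x) := fun x y => by simp [gap]
    rw [e, e, ih]
    simp only at h h'
    rw [h, h']

variable [IsOrderedAddMonoid R]

theorem exists_iterate_eq_of_le {D : Set R} {d : R} {n : ℕ}
    (hpos : ∀ l < n, 0 < gap D ((succIn D)^[l] d)) {x : R} (hx : x ∈ D) (hdx : d ≤ x)
    (hxn : x ≤ (succIn D)^[n] d) : ∃ l ≤ n, x = (succIn D)^[l] d := by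
  induction n with
  | zero => exact ⟨0, le_rfl, le_antisymm hxn hdx⟩
  | succ n ih =>
    by_cases h : x ≤ (succIn D)^[n] d
    · obtain ⟨l, hl, hxl⟩ := ih (fun l hl => hpos l (by omega)) h
      exact ⟨l, by omega, hxl⟩
    · refine ⟨n + 1, le_rfl, le_antisymm hxn ?_⟩
      have hlt := hpos n (by omega)
      rw [Function.iterate_succ_apply']
      exact (isLeast_succIn_of_ne (sub_pos.1 hlt).ne').2 ⟨hx, not_le.1 h⟩

/-- With the converse below, this turns membership in `P_σ` into agreement of two translates of `D`
on an interval. The resulting formula is the same for all `n`, which makes the later bound uniform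
in the length. -/
theorem mem_iff_mem_of_mem_patternSet {D : Set R} {n : ℕ} {σ : Fin n → R} (hσ : ∀ l, 0 < σ l)
    {d d' : R} (hd : d ∈ patternSet D σ) (hd' : d' ∈ patternSet D σ) {z : R} (hz : 0 ≤ z)
    (hzn : z ≤ (succIn D)^[n] d - d) : d + z ∈ D ↔ d' + z ∈ D := by
  have key : ∀ d d', d ∈ patternSet D σ → d' ∈ patternSet D σ → z ≤ (succIn D)^[n] d - d →
      d + z ∈ D → d' + z ∈ D := by
    intro d d' hd hd' hzn h
    obtain ⟨l, hl, hdz⟩ := exists_iterate_eq_of_le (n := n)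
      (fun l hl => by rw [hd.2 ⟨l, hl⟩]; exact hσ _) h (le_add_of_nonneg_right hz)
      (le_sub_iff_add_le'.1 hzn)
    have := iterate_sub_eq_of_mem_patternSet hd hd' hl
    rw [← hdz, add_sub_cancel_left] at this
    rw [this, add_sub_cancel]
    exact iterate_succIn_mem hd'.1 l
  exact ⟨key d d' hd hd' hzn,
    key d' d hd' hd (by rwa [← iterate_sub_eq_of_mem_patternSet hd hd' le_rfl])⟩

theorem mem_patternSet_of_mem_iff_mem {D : Set R} {n : ℕ} {σ : Fin n → R} (hσ : ∀ l, 0 < σ l)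
    {d d' : R} (hd : d ∈ patternSet D σ) (hd' : d' ∈ D)
    (h : ∀ z, 0 ≤ z → z ≤ (succIn D)^[n] d - d → (d + z ∈ D ↔ d' + z ∈ D)) :
    d' ∈ patternSet D σ := by
  have hstep : ∀ l < n, (succIn D)^[l] d' = d' + ((succIn D)^[l] d - d) →
      succIn D ((succIn D)^[l] d') = d' + (succIn D ((succIn D)^[l] d) - d) := by
    intro l hl heq
    have hgap : 0 < gap D ((succIn D)^[l] d) := by
      rw [hd.2 ⟨l, hl⟩]
      exact hσ _
    have hleast := isLeast_succIn_of_ne (sub_pos.1 hgap).ne'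
    have hle : succIn D ((succIn D)^[l] d) ≤ (succIn D)^[n] d := by
      rw [← Function.iterate_succ_apply' (succIn D) l d]
      exact monotone_iterate_succIn D d hl
    have hge : d ≤ (succIn D)^[l] d := monotone_iterate_succIn D d (Nat.zero_le l)
    refine IsLeast.succIn_eq ⟨⟨?_, ?_⟩, ?_⟩
    · rw [← h _ (sub_nonneg.2 (hge.trans hleast.1.2.le)) (by gcongr), add_sub_cancel]
      exact hleast.1.1
    · rw [heq]
      gcongr
      exact hleast.1.2
    · rintro x ⟨hx, hlt⟩
      by_contra! hxlt
      have h0 : 0 ≤ x - d' := by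
        rw [heq] at hlt
        exact sub_nonneg.2 ((le_add_of_nonneg_right (sub_nonneg.2 hge)).trans hlt.le)
      have h1 : x - d' < succIn D ((succIn D)^[l] d) - d := sub_lt_iff_lt_add'.2 hxlt
      have h2 : d + (x - d') ∈ D := by
        rw [h _ h0 (h1.le.trans (by gcongr)), add_sub_cancel]
        exact hx
      have h3 : (succIn D)^[l] d < d + (x - d') := by
        rw [heq] at hlt
        rw [← sub_lt_iff_lt_add', lt_sub_iff_add_lt']
        exact hlt
      exact absurd (hleast.2 ⟨h2, h3⟩) (not_le.2 (lt_sub_iff_add_lt'.1 h1))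
  have hall : ∀ l ≤ n, (succIn D)^[l] d' = d' + ((succIn D)^[l] d - d) := by
    intro l
    induction l with
    | zero => simp
    | succ l ih =>
      intro hl
      rw [Function.iterate_succ_apply', Function.iterate_succ_apply']
      exact hstep l hl (ih (by omega))
  refine ⟨hd', fun l => ?_⟩
  rw [← hd.2 l, gap, hstep l l.2 (hall l l.2.le), hall l l.2.le, gap]
  abel

end Words

/-! ### A bound on the number of recurrent words, uniform in the length. -/

section WordBound

variable {L : FirstOrder.Language.{u, v}} {R : Type w} [L.Structure R]
  [AddCommGroup R] [LinearOrder R] [IsOrderedAddMonoid R]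

theorem DefWellOrdered.pos_of_mem_diffSet (hexp : ExpandsOAG L R) {D : Set R}
    (hD : (Set.univ : Set R).Definable₁ L D) (h : DefWellOrdered L D) {c : R}
    (hc : c ∈ diffSet D) : 0 < c := by
  obtain ⟨a, -, hb, rfl⟩ := hc
  exact sub_pos.2 (h.isLeast_succIn hexp hD hb).1.2

theorem DefWellOrdered.exists_rightIsolated (hexp : ExpandsOAG L R) {D : Set R}
    (hD : (Set.univ : Set R).Definable₁ L D) (h : DefWellOrdered L D)
    (hfin : (diffSet D).Finite) (hne : (diffSet D).Nonempty) :
    ∃ s > 0, ∀ d ∈ D, RightIsolated (· ∈ D) s d := by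
  obtain ⟨s, hs, hmin⟩ := hfin.exists_minimal hne
  refine ⟨s, h.pos_of_mem_diffSet hexp hD hs, fun d hd => ⟨hd, fun z hz hdz => ?_⟩⟩
  have hsd : s ≤ gap D d := by
    by_contra! hlt
    exact absurd (hmin ⟨d, hd, ⟨z, hz, hdz⟩, rfl⟩ hlt.le) (not_le.2 hlt)
  have := (h.isLeast_succIn hexp hD ⟨z, hz, hdz⟩).2 ⟨hz, hdz⟩
  exact (le_sub_iff_add_le'.1 hsd).trans this

/-- In burden at most `2`, there is a bound on the number of patterns of differences of the same
length that can all recur in the same number of disjoint intervals. -/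
theorem exists_bound_words (hexp : ExpandsOAG L R)
    (hdiv : ∀ (g : R) (n : ℕ), 0 < n → ∃ h : R, n • h = g)
    (hB : BurdenLT.{u, v, w} (L.completeTheory R) 3)
    {D : Set R} (hD : (Set.univ : Set R).Definable₁ L D) (h : DefWellOrdered L D)
    (hfin : (diffSet D).Finite) :
    ∃ M : ℕ, ∀ (n : ℕ) (W : ℕ → Fin n → R) (δ : ℕ → ℕ → R) (α β : ℕ → R),
      (∀ i < M, ∀ i' < M, W i = W i' → i = i') →
      (∀ i < M, ∀ l, W i l ∈ diffSet D) →
      (∀ i < M, ∀ j < M, δ i j ∈ patternSet D (W i) ∧ α j ≤ δ i j ∧ δ i j < β j) →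
      (∀ j < M, β j ∈ D) →
      (∀ j < M, ∀ j' < M, j ≠ j' → β j ≤ α j' ∨ β j' ≤ α j) → False := by
  -- The digits of `x` are its interval `[α j, β j)`, the word starting at the last point of `D` up
  -- to `x`, and the offset from that point. The path `(a, b, c)` is realised by `δ b a + c • g`.
  obtain ⟨N, hN⟩ := exists_bound_three_rows hB (k := 3)
    (S₀ := fun x y => y 0 ≤ x ∧ x < y 1)
    (S₁ := fun x y => ∃ d, d ∈ D ∧ d ≤ x ∧ x < d + y 2 ∧
      ∀ z, 0 ≤ z → z ≤ y 1 → (y 0 + z ∈ D ↔ d + z ∈ D))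
    (S₂ := fun x y => ∃ d, d ∈ D ∧ d ≤ x ∧ x < d + y 2 ∧ d + y 0 ≤ x ∧ x < d + y 1)
    (by repeat' first
          | apply DefPred.and | apply DefPred.le hexp | apply DefPred.lt hexp | apply DefTerm.proj)
    (by repeat' first
          | apply DefPred.and | apply DefPred.iff | apply DefPred.imp | apply DefPred.ex
          | apply DefPred.all | apply DefPred.mem hD | apply DefPred.le hexp
          | apply DefPred.lt hexp | apply DefTerm.proj | apply DefTerm.const
          | apply DefTerm.add hexp)
    (by repeat' first
          | apply DefPred.and | apply DefPred.ex | apply DefPred.mem hD | apply DefPred.le hexp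
          | apply DefPred.lt hexp | apply DefTerm.proj | apply DefTerm.add hexp)
  -- Two extra words guarantee that `W 0 ≠ W 1`, which forces `D'` to be nonempty.
  refine ⟨N + 2, fun n W δ α β hinj hW hδ hβ hdisj => ?_⟩
  have hne : (diffSet D).Nonempty := by
    by_contra hempty
    have : W 0 = W 1 := funext fun l => absurd ⟨_, hW 0 (by omega) l⟩ hempty
    exact absurd (hinj 0 (by omega) 1 (by omega) this) (by omega)
  obtain ⟨s, hs, hsep⟩ := h.exists_rightIsolated hexp hD hfin hne
  have hpos : ∀ i < N, ∀ l, 0 < W i l := fun i hi l =>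
    h.pos_of_mem_diffSet hexp hD (hW i (by omega) l)
  have hδ' : ∀ i < N, ∀ j < N, δ i j ∈ patternSet D (W i) := fun i hi j hj =>
    (hδ i (by omega) j (by omega)).1
  obtain ⟨g, hg⟩ := hdiv s (N + 1) N.succ_pos
  have hg0 : 0 < g := by
    rw [← hg] at hs
    exact (nsmul_pos_iff N.succ_ne_zero).1 hs
  refine hN (fun j => ![α j, β j, s])
    (fun i => ![δ i 0, (succIn D)^[n] (δ i 0) - δ i 0, s])
    (fun c => ![c • g, (c + 1) • g, s]) ?_ ?_ ?_ ?_
  · rintro j hj j' hj' hne x ⟨h₁, h₂⟩ ⟨h₁', h₂'⟩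
    rcases hdisj j (by omega) j' (by omega) hne with h | h
    · exact absurd (h₂.trans_le h) (not_lt.2 h₁')
    · exact absurd (h₂'.trans_le h) (not_lt.2 h₁)
  · rintro j hj j' hj' hne x ⟨d, hd, h₁, h₂, h₃⟩ ⟨d', hd', h₁', h₂', h₃'⟩
    obtain rfl := (hsep d hd).unique (hsep d' hd') h₁ h₂ h₁' h₂'
    have m := mem_patternSet_of_mem_iff_mem (hpos j hj) (hδ' j hj 0 (by omega)) hd h₃
    have m' := mem_patternSet_of_mem_iff_mem (hpos j' hj') (hδ' j' hj' 0 (by omega)) hd h₃'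
    exact hne (hinj j (by omega) j' (by omega) (funext fun l => (m.2 l).symm.trans (m'.2 l)))
  · rintro j hj j' hj' hne x ⟨d, hd, h₁, h₂, h₃, h₄⟩ ⟨d', hd', h₁', h₂', h₃', h₄'⟩
    obtain rfl := (hsep d hd).unique (hsep d' hd') h₁ h₂ h₁' h₂'
    exact hne (nsmul_interval_unique hg0 h₃ h₄ h₃' h₄')
  · intro a ha b hb c hc
    obtain ⟨hp, hα, hlt⟩ := hδ b (by omega) a (by omega)
    have h1 : δ b a ≤ δ b a + c • g := le_add_of_nonneg_right (nsmul_nonneg hg0.le c)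
    have h2 : δ b a + c • g < δ b a + s := by
      rw [add_lt_add_iff_left, ← hg, nsmul_lt_nsmul_iff_left hg0]
      omega
    refine ⟨δ b a + c • g,
      -- Since `β a` lies in `D` beyond `δ b a`, it is at least `s` away, and the offset does not
      -- leave the interval.
      ⟨hα.trans h1, h2.trans_le ((hsep _ hp.1).2 _ (hβ a (by omega)) hlt)⟩,
      ⟨δ b a, hp.1, h1, h2, fun z hz hzt => ?_⟩, ⟨δ b a, hp.1, h1, h2, le_rfl, ?_⟩⟩
    · exact mem_iff_mem_of_mem_patternSet (hpos b hb) (hδ' b hb 0 (by omega)) hp hz hzt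
    · change δ b a + c • g < δ b a + (c + 1) • g
      rw [add_lt_add_iff_left, nsmul_lt_nsmul_iff_left hg0]
      omega

theorem exists_enumeration_of_le_encard {X : Type*} [Nonempty X] {s : Set X} {N : ℕ}
    (h : (N : ℕ∞) ≤ s.encard) :
    ∃ W : ℕ → X, (∀ i < N, W i ∈ s) ∧ ∀ i < N, ∀ i' < N, W i = W i' → i = i' := by
  obtain ⟨t, hts, ht⟩ := Set.exists_subset_encard_eq h
  have hfin : t.Finite := Set.finite_of_encard_eq_coe ht
  obtain ⟨W, hW, hinj⟩ : ∃ f : ℕ → X, (∀ i < N, f i ∈ t) ∧ Set.InjOn f (Set.Iio N) := by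
    have : (Set.Iio N).encard ≤ t.encard := by
      rw [ht, Set.encard_eq_coe_toFinset_card]
      simp
    obtain ⟨f, hf, hfi⟩ := (Set.finite_Iio N).exists_injOn_of_encard_le this
    exact ⟨f, fun i hi => hf hi, hfi⟩
  exact ⟨W, fun i hi => hts (hW i hi), fun i hi i' hi' e => hinj hi hi' e⟩

/-- The patterns of differences of length `n` that start at infinitely many of the points `x k`. -/
def recurrentPatterns (D : Set R) (x : ℕ → R) (n : ℕ) : Set (Fin n → R) :=
  {σ | (∀ i, σ i ∈ diffSet D) ∧ ∃ᶠ k in atTop, x k ∈ patternSet D σ}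

/-- Given `M` recurrent words, the sequence can be cut into consecutive blocks each containing an
occurrence of all of them; the blocks are the disjoint intervals of `exists_bound_words`. -/
theorem exists_bound_recurrentPatterns (hexp : ExpandsOAG L R)
    (hdiv : ∀ (g : R) (n : ℕ), 0 < n → ∃ h : R, n • h = g)
    (hB : BurdenLT.{u, v, w} (L.completeTheory R) 3)
    {D : Set R} (hD : (Set.univ : Set R).Definable₁ L D) (h : DefWellOrdered L D)
    (hfin : (diffSet D).Finite) :
    ∃ M : ℕ, ∀ (x : ℕ → R), (∀ k, x k ∈ D) → StrictMono x ∨ StrictAnti x →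
      ∀ n, (recurrentPatterns D x n).encard ≤ M := by
  obtain ⟨M, hM⟩ := exists_bound_words hexp hdiv hB hD h hfin
  refine ⟨M, fun x hx hmono n => ?_⟩
  by_contra! hlt
  obtain ⟨W, hW, hinj⟩ := exists_enumeration_of_le_encard hlt.le
  have hnext : ∀ K : ℕ, ∃ K' > K, ∀ i < M, ∃ k, K < k ∧ k < K' ∧ x k ∈ patternSet D (W i) := by
    intro K
    have : ∀ i, ∃ k, K < k ∧ (i < M → x k ∈ patternSet D (W i)) := by
      intro i
      by_cases hi : i < M
      · obtain ⟨k, hk, hkW⟩ := frequently_atTop.1 (hW i hi).2 (K + 1)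
        exact ⟨k, hk, fun _ => hkW⟩
      · exact ⟨K + 1, by omega, fun h => absurd h hi⟩
    choose k hk hkW using this
    refine ⟨K + 1 + ∑ i ∈ Finset.range M, k i, by omega, fun i hi => ⟨k i, hk i, ?_, hkW i hi⟩⟩
    have := Finset.single_le_sum (f := k) (fun _ _ => Nat.zero_le _) (Finset.mem_range.2 hi)
    omega
  choose f hf hfk using hnext
  let κ : ℕ → ℕ := fun j => f^[j] 0
  have hκ : ∀ j, κ (j + 1) = f (κ j) := fun j => Function.iterate_succ_apply' _ _ _
  have hκmono : StrictMono κ := strictMono_nat_of_lt_succ fun j => by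
    rw [hκ]
    exact hf _
  have hpos : ∀ i j, ∃ k, κ j < k ∧ k < κ (j + 1) ∧ (i < M → x k ∈ patternSet D (W i)) := by
    intro i j
    rw [hκ]
    by_cases hi : i < M
    · obtain ⟨k, h₁, h₂, h₃⟩ := hfk (κ j) i hi
      exact ⟨k, h₁, h₂, fun _ => h₃⟩
    · by_cases hM0 : 0 < M
      · obtain ⟨k, h₁, h₂, -⟩ := hfk (κ j) 0 hM0
        exact ⟨k, h₁, h₂, fun h => absurd h hi⟩
      -- For `M = 0` the hypotheses of the bound hold vacuously, so this case is contradictory.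
      · exact (hM n W (fun _ _ => 0) x x (by omega) (by omega) (by omega) (by omega)
          (by omega)).elim
  choose k hk₁ hk₂ hk using hpos
  rcases hmono with hmono | hmono
  · refine hM n W (fun i j => x (k i j)) (fun j => x (κ j)) (fun j => x (κ (j + 1))) hinj
      (fun i hi => (hW i hi).1) (fun i hi j _ => ⟨hk i j hi, (hmono (hk₁ i j)).le,
        hmono (hk₂ i j)⟩) (fun j _ => hx _) (fun j _ j' _ hne => ?_)
    rcases hne.lt_or_gt with hlt | hlt
    · exact Or.inl (hmono.monotone (hκmono.monotone hlt))
    · exact Or.inr (hmono.monotone (hκmono.monotone hlt))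
  · refine hM n W (fun i j => x (k i j)) (fun j => x (κ (j + 1))) (fun j => x (κ j)) hinj
      (fun i hi => (hW i hi).1) (fun i hi j _ => ⟨hk i j hi, (hmono (hk₂ i j)).le,
        hmono (hk₁ i j)⟩) (fun j _ => hx _) (fun j _ j' _ hne => ?_)
    rcases hne.lt_or_gt with hlt | hlt
    · exact Or.inr (hmono.antitone (hκmono.monotone hlt))
    · exact Or.inl (hmono.antitone (hκmono.monotone hlt))

end WordBound

/-! ### Recurrent words and periodicity of sequences. -/

section Recurrence

/-- A deterministic sequence with `m` values, all of which recur, is periodic with period `m`. -/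
theorem map_add_ncard_range {X : Type*} {V : ℕ → X}
    (hdet : ∀ k l, V k = V l → V (k + 1) = V (l + 1)) (hfin : (Set.range V).Finite)
    (hrec : ∀ k, ∃ᶠ l in atTop, V l = V k) (k : ℕ) : V (k + (Set.range V).ncard) = V k := by
  classical
  set m := (Set.range V).ncard with hm
  -- A repetition `V i = V j` with `i < j ≤ m` makes `V` periodic from `i` on. By recurrence all `m`
  -- values occur there, so `m ≤ j - i`, which leaves only `i = 0` and `j = m`.
  obtain ⟨i, hi, j, hj, hne, heq⟩ := Finset.exists_ne_map_eq_of_card_lt_of_maps_to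
    (s := Finset.range (m + 1)) (t := hfin.toFinset) (f := V)
    (by rw [← Set.ncard_eq_toFinset_card _ hfin, Finset.card_range]; omega)
    (fun i _ => by simp)
  wlog hij : i < j generalizing i j
  · exact this j hj i hi hne.symm heq.symm (by omega)
  simp only [Finset.mem_range] at hi hj
  have hdet' : ∀ n k l, V k = V l → V (k + n) = V (l + n) := by
    intro n k l h
    induction n with
    | zero => exact h
    | succ n ih => exact hdet _ _ ih
  have hper : Function.Periodic (fun t => V (i + t)) (j - i) := by
    intro t
    have := hdet' t i j heq
    simp only
    rw [this]
    congr 1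
    omega
  have hsub : Set.range V ⊆ (fun t => V (i + t)) '' (Finset.range (j - i) : Set ℕ) := by
    rintro _ ⟨k, rfl⟩
    obtain ⟨l, hl, hlk⟩ := frequently_atTop.1 (hrec k) i
    refine ⟨(l - i) % (j - i), ?_, ?_⟩
    · simpa using Nat.mod_lt _ (by omega)
    · refine (hper.map_mod_nat _).trans ?_
      rw [← hlk]
      congr 1
      omega
  have hle : m ≤ j - i := by
    refine (Set.ncard_le_ncard hsub (Set.toFinite _)).trans ((Set.ncard_image_le
      (Set.toFinite _)).trans ?_)
    rw [Set.ncard_coe_finset, Finset.card_range]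
  obtain rfl : i = 0 := by omega
  obtain rfl : j = m := by omega
  have := hdet' k 0 m heq
  rw [add_comm k m, ← this, zero_add]

variable {X : Type*}

/-- The words of length `n` that occur infinitely often in the sequence `g`. -/
def recurrentWords (g : ℕ → X) (n : ℕ) : Set (Fin n → X) :=
  {σ | ∃ᶠ k in atTop, ∀ i : Fin n, g (k + i) = σ i}

variable {g : ℕ → X}

theorem finite_words (hfin : (Set.range g).Finite) (n : ℕ) :
    (Set.univ.pi fun _ : Fin n => Set.range g).Finite :=
  Set.Finite.pi fun _ => hfin

theorem finite_recurrentWords (hfin : (Set.range g).Finite) (n : ℕ) :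
    (recurrentWords g n).Finite := by
  refine (finite_words hfin n).subset fun σ hσ i _ => ?_
  obtain ⟨k, hk⟩ := hσ.exists
  exact ⟨_, hk i⟩

/-- There are only finitely many words, and each nonrecurrent one eventually stops occurring. -/
theorem eventually_mem_recurrentWords (hfin : (Set.range g).Finite) (n : ℕ) :
    ∀ᶠ k in atTop, (fun i : Fin n => g (k + i)) ∈ recurrentWords g n := by
  have h : ∀ᶠ k in atTop, ∀ σ ∈ Set.univ.pi fun _ : Fin n => Set.range g,
      σ ∉ recurrentWords g n → ¬ ∀ i : Fin n, g (k + i) = σ i := by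
    rw [(finite_words hfin n).eventually_all]
    intro σ _
    by_cases hσ : σ ∈ recurrentWords g n
    · exact Eventually.of_forall fun _ h => absurd hσ h
    · exact (not_frequently.1 hσ).mono fun _ h _ => h
  filter_upwards [h] with k hk
  by_contra hcon
  exact hk _ (fun i _ => ⟨_, rfl⟩) hcon fun _ => rfl

theorem image_init_recurrentWords (hfin : (Set.range g).Finite) (n : ℕ) :
    (fun σ : Fin (n + 1) → X => fun i : Fin n => σ i.castSucc) '' recurrentWords g (n + 1) =
      recurrentWords g n := by
  apply Set.Subset.antisymm
  · rintro _ ⟨σ, hσ, rfl⟩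
    exact Frequently.mono hσ fun k hk i => hk i.castSucc
  · intro σ hσ
    obtain ⟨k, hk, hk'⟩ := (Frequently.and_eventually hσ
      (eventually_mem_recurrentWords hfin (n + 1))).exists
    exact ⟨_, hk', funext hk⟩

/-- A sequence with finitely many values and boundedly many recurrent words of each length is
eventually periodic, and the eventual number of recurrent words is a period. -/
theorem exists_period_of_recurrentWords (hfin : (Set.range g).Finite) {M : ℕ}
    (hM : ∀ n, (recurrentWords g n).encard ≤ M) :
    ∃ m : ℕ, 0 < m ∧ (∀ᶠ n in atTop, (recurrentWords g n).encard = m) ∧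
      ∃ K, ∀ k ≥ K, g (k + m) = g k := by
  have hfinw := finite_recurrentWords hfin
  have hmono : Monotone fun n => (recurrentWords g n).ncard :=
    monotone_nat_of_le_succ fun n => by
      rw [← image_init_recurrentWords hfin n]
      exact Set.ncard_image_le (hfinw _)
  have hbdd : ∀ n, (recurrentWords g n).ncard ≤ M := fun n => by
    have := hM n
    rw [← (hfinw n).cast_ncard_eq] at this
    exact_mod_cast this
  obtain ⟨n₀, hn₀⟩ : ∃ n₀, ∀ n ≥ n₀, (recurrentWords g n).ncard = (recurrentWords g n₀).ncard := by
    have hfinr : (Set.range fun n => (recurrentWords g n).ncard).Finite :=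
      (Set.finite_Iic M).subset (by
        rintro _ ⟨n, rfl⟩
        exact hbdd n)
    obtain ⟨_, ⟨n₀, rfl⟩, hmax⟩ := hfinr.exists_maximal (Set.range_nonempty _)
    exact ⟨n₀, fun n hn => le_antisymm (hmax ⟨n, rfl⟩ (hmono hn)) (hmono hn)⟩
  set m := (recurrentWords g n₀).ncard with hm
  -- The shift keeps `n` positive, so that coordinate `0` of a window can be read at the end.
  let n := n₀ + 1
  -- Truncation maps the recurrent words of length `n + 1` onto those of length `n`. As the two sets
  -- have the same size, each recurrent word has a unique recurrent extension; past `K` a window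
  -- thus determines the next.
  have hinj : Set.InjOn (fun σ : Fin (n + 1) → X => fun i : Fin n => σ i.castSucc)
      (recurrentWords g (n + 1)) := by
    refine Set.injOn_of_ncard_image_eq ?_ (hfinw _)
    rw [image_init_recurrentWords hfin n, hn₀ n (by omega), hn₀ (n + 1) (by omega)]
  obtain ⟨K, hK⟩ := eventually_atTop.1 (eventually_mem_recurrentWords hfin (n + 1))
  let V : ℕ → Fin n → X := fun k i => g (K + k + i)
  have hVmem : ∀ k, V k ∈ recurrentWords g n := fun k => by
    rw [← image_init_recurrentWords hfin n]
    exact ⟨_, hK (K + k) (by omega), rfl⟩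
  have hfreq : ∀ σ ∈ recurrentWords g n, ∃ᶠ l in atTop, V l = σ := by
    intro σ hσ
    rw [frequently_atTop]
    intro l
    obtain ⟨k, hk, hkσ⟩ := frequently_atTop.1 hσ (K + l)
    refine ⟨k - K, by omega, funext fun i => ?_⟩
    rw [← hkσ i]
    change g _ = g _
    congr 1
    omega
  have hrange : Set.range V = recurrentWords g n := by
    apply Set.Subset.antisymm
    · rintro _ ⟨k, rfl⟩
      exact hVmem k
    · intro σ hσ
      obtain ⟨k, hk⟩ := (hfreq σ hσ).exists
      exact ⟨k, hk⟩
  have hdet : ∀ k l, V k = V l → V (k + 1) = V (l + 1) := by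
    intro k l h
    have h' := hinj (hK (K + k) (by omega)) (hK (K + l) (by omega)) h
    funext i
    have := congrFun h' i.succ
    simpa [V, add_assoc, add_comm, add_left_comm] using this
  have hper := map_add_ncard_range hdet (by rw [hrange]; exact hfinw n)
    (fun k => hfreq _ (hVmem k))
  rw [hrange, hn₀ n (by omega)] at hper
  refine ⟨m, ?_, ?_, K, fun k hk => ?_⟩
  · rw [← hn₀ n (by omega), Set.ncard_pos (hfinw n)]
    exact ⟨_, hVmem 0⟩
  · filter_upwards [eventually_ge_atTop n₀] with k hk
    rw [← (hfinw k).cast_ncard_eq, hn₀ k hk]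
  · have := congrFun (hper (k - K)) 0
    simp only [V, Fin.val_zero, add_zero] at this
    rwa [show K + (k - K + m) = k + m by omega, show K + (k - K) = k by omega] at this

end Recurrence

/-! ### Recurrent words and periods of `ℤ`-chains. -/

section Chains

variable {R : Type w} [LinearOrder R]

theorem iterate_predIn_mem {D : Set R} {d : R} (hd : d ∈ D) (n : ℕ) : (predIn D)^[n] d ∈ D := by
  induction n with
  | zero => exact hd
  | succ n ih =>
    rw [Function.iterate_succ_apply']
    exact predIn_mem ih

theorem antitone_iterate_predIn (D : Set R) (d : R) : Antitone fun n => (predIn D)^[n] d :=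
  antitone_nat_of_succ_le fun n => by
    rw [Function.iterate_succ_apply']
    exact predIn_le _ _

theorem iterate_fixed_le {α : Type*} [Preorder α] {f : α → α} {a : α} {k : ℕ}
    (hmono : Monotone fun n => f^[n] a) (h : f (f^[k] a) = f^[k] a) (n : ℕ) :
    f^[n] a ≤ f^[k] a := by
  rcases le_total n k with hn | hn
  · exact hmono hn
  · obtain ⟨m, rfl⟩ := Nat.exists_eq_add_of_le' hn
    rw [Function.iterate_add_apply, Function.iterate_fixed h]

/-- If the iteration stalled, the point where it stalls would be the greatest element of the chain.
-/
theorem strictMono_iterate_succIn {D : Set R} {a : R}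
    (hZ : ¬ ∃ c, IsGreatest (zChain D a) c) : StrictMono fun n => (succIn D)^[n] a := by
  refine strictMono_nat_of_lt_succ fun k => ?_
  rw [Function.iterate_succ_apply']
  refine (le_succIn _ _).lt_of_ne fun heq => hZ ⟨_, ⟨k, Or.inl rfl⟩, ?_⟩
  rintro _ ⟨n, rfl | rfl⟩
  · exact iterate_fixed_le (monotone_iterate_succIn D a) heq.symm n
  · exact (antitone_iterate_predIn D a (Nat.zero_le n)).trans
      (monotone_iterate_succIn D a (Nat.zero_le k))

theorem strictAnti_iterate_predIn {D : Set R} {a : R}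
    (hZ : ¬ ∃ c, IsLeast (zChain D a) c) : StrictAnti fun n => (predIn D)^[n] a := by
  refine strictAnti_nat_of_succ_lt fun k => ?_
  rw [Function.iterate_succ_apply']
  refine (predIn_le _ _).lt_of_ne fun heq => hZ ⟨_, ⟨k, Or.inr rfl⟩, ?_⟩
  rintro _ ⟨n, rfl | rfl⟩
  · exact (antitone_iterate_predIn D a (Nat.zero_le k)).trans
      (monotone_iterate_succIn D a (Nat.zero_le n))
  · exact iterate_fixed_le (α := Rᵒᵈ) (antitone_iterate_predIn D a) heq n

theorem exists_iterate_succIn_of_lt {D : Set R} {a b : R} {k : ℕ} (hb : b ∈ zChain D a)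
    (h : (succIn D)^[k] a < b) : ∃ n > k, b = (succIn D)^[n] a := by
  obtain ⟨n, rfl | rfl⟩ := hb
  · exact ⟨n, lt_of_not_ge fun hn => absurd (monotone_iterate_succIn D a hn) (not_le.2 h), rfl⟩
  · exact absurd ((antitone_iterate_predIn D a (Nat.zero_le n)).trans
      (monotone_iterate_succIn D a (Nat.zero_le k))) (not_le.2 h)

theorem exists_iterate_predIn_of_lt {D : Set R} {a b : R} {k : ℕ} (hb : b ∈ zChain D a)
    (h : b < (predIn D)^[k] a) : ∃ n > k, b = (predIn D)^[n] a := by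
  obtain ⟨n, rfl | rfl⟩ := hb
  · exact absurd ((antitone_iterate_predIn D a (Nat.zero_le k)).trans
      (monotone_iterate_succIn D a (Nat.zero_le n))) (not_le.2 h)
  · exact ⟨n, lt_of_not_ge fun hn => absurd (antitone_iterate_predIn D a hn) (not_le.2 h), rfl⟩

theorem iterate_succIn_iterate_predIn {D : Set R} {a : R} (ha : a ∈ D)
    (hanti : StrictAnti fun n => (predIn D)^[n] a) {i k : ℕ} (hik : i ≤ k) :
    (succIn D)^[i] ((predIn D)^[k] a) = (predIn D)^[k - i] a := by
  induction i with
  | zero => rfl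
  | succ i ih =>
    rw [Function.iterate_succ_apply', ih (by omega)]
    have hlt := hanti (show k - (i + 1) < k - i by omega)
    rw [show k - i = k - (i + 1) + 1 by omega] at hlt ⊢
    simp only [Function.iterate_succ_apply'] at hlt ⊢
    exact succIn_predIn (iterate_predIn_mem ha _) hlt.ne

variable [AddCommGroup R]

theorem patternsUnboundedAbove_eq_empty {D Z : Set R} (h : ∃ c, IsGreatest Z c) (n : ℕ) :
    patternsUnboundedAbove D Z n = ∅ := by
  obtain ⟨c, hc⟩ := h
  exact Set.eq_empty_of_forall_notMem fun σ hσ => hσ.2 ⟨c, hc.1, fun x hx => hc.2 hx.2⟩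

theorem patternsUnboundedBelow_eq_empty {D Z : Set R} (h : ∃ c, IsLeast Z c) (n : ℕ) :
    patternsUnboundedBelow D Z n = ∅ := by
  obtain ⟨c, hc⟩ := h
  exact Set.eq_empty_of_forall_notMem fun σ hσ => hσ.2 ⟨c, hc.1, fun x hx => hc.2 hx.2⟩

theorem patternsUnboundedAbove_eq {D : Set R} {a : R}
    (hmono : StrictMono fun n => (succIn D)^[n] a) (n : ℕ) :
    patternsUnboundedAbove D (zChain D a) n =
      recurrentPatterns D (fun k => (succIn D)^[k] a) n := by
  ext σ
  refine and_congr_right fun _ => ?_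
  rw [frequently_atTop]
  push Not
  constructor
  · intro h k
    obtain ⟨c, hc, hlt⟩ := h _ ⟨k, Or.inl rfl⟩
    obtain ⟨l, hl, rfl⟩ := exists_iterate_succIn_of_lt hc.2 hlt
    exact ⟨l, hl.le, hc.1⟩
  · rintro h _ ⟨k, hk⟩
    obtain ⟨l, hl, hlσ⟩ := h (k + 1)
    refine ⟨_, ⟨hlσ, ⟨l, Or.inl rfl⟩⟩, ?_⟩
    rcases hk with rfl | rfl
    · exact hmono hl
    · exact (antitone_iterate_predIn D a (Nat.zero_le k)).trans_lt (hmono (by omega : 0 < l))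

theorem patternsUnboundedBelow_eq {D : Set R} {a : R}
    (hanti : StrictAnti fun n => (predIn D)^[n] a) (n : ℕ) :
    patternsUnboundedBelow D (zChain D a) n =
      recurrentPatterns D (fun k => (predIn D)^[k] a) n := by
  ext σ
  refine and_congr_right fun _ => ?_
  rw [frequently_atTop]
  push Not
  constructor
  · intro h k
    obtain ⟨c, hc, hlt⟩ := h _ ⟨k, Or.inr rfl⟩
    obtain ⟨l, hl, rfl⟩ := exists_iterate_predIn_of_lt hc.2 hlt
    exact ⟨l, hl.le, hc.1⟩
  · rintro h _ ⟨k, hk⟩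
    obtain ⟨l, hl, hlσ⟩ := h (k + 1)
    refine ⟨_, ⟨hlσ, ⟨l, Or.inr rfl⟩⟩, ?_⟩
    rcases hk with rfl | rfl
    · exact (hanti (by omega : 0 < l)).trans_le (monotone_iterate_succIn D a (Nat.zero_le k))
    · exact hanti hl

theorem gap_iterate_succIn_mem {D : Set R} {a : R} (ha : a ∈ D)
    (hmono : StrictMono fun n => (succIn D)^[n] a) (k : ℕ) :
    gap D ((succIn D)^[k] a) ∈ diffSet D :=
  ⟨_, iterate_succIn_mem ha k, ⟨_, iterate_succIn_mem ha (k + 1), hmono k.lt_succ_self⟩, rfl⟩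

theorem gap_iterate_predIn_mem {D : Set R} {a : R} (ha : a ∈ D)
    (hanti : StrictAnti fun n => (predIn D)^[n] a) {k : ℕ} (hk : 0 < k) :
    gap D ((predIn D)^[k] a) ∈ diffSet D :=
  ⟨_, iterate_predIn_mem ha k, ⟨_, iterate_predIn_mem ha 0, hanti hk⟩, rfl⟩

theorem recurrentPatterns_iterate_succIn {D : Set R} {a : R} (ha : a ∈ D)
    (hmono : StrictMono fun n => (succIn D)^[n] a) (n : ℕ) :
    recurrentPatterns D (fun k => (succIn D)^[k] a) n =
      recurrentWords (fun k => gap D ((succIn D)^[k] a)) n := by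
  have key : ∀ (σ : Fin n → R) (k : ℕ), (succIn D)^[k] a ∈ patternSet D σ ↔
      ∀ i : Fin n, gap D ((succIn D)^[k + i] a) = σ i := by
    intro σ k
    rw [patternSet, Set.mem_ofPred_eq, and_iff_right (iterate_succIn_mem ha k)]
    simp only [← Function.iterate_add_apply, add_comm]
  ext σ
  simp only [recurrentPatterns, recurrentWords, Set.mem_ofPred_eq, key, and_iff_right_iff_imp]
  intro h i
  obtain ⟨k, hk⟩ := h.exists
  rw [← hk i]
  exact gap_iterate_succIn_mem ha hmono _

/-- Words are read to the right while the sequence runs to the left; reversing words is injective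
and matches the two counts. -/
theorem encard_recurrentPatterns_iterate_predIn {D : Set R} {a : R} (ha : a ∈ D)
    (hanti : StrictAnti fun n => (predIn D)^[n] a) (n : ℕ) :
    (recurrentPatterns D (fun k => (predIn D)^[k] a) n).encard =
      (recurrentWords (fun k => gap D ((predIn D)^[k] a)) n).encard := by
  have hinj : Function.Injective fun (σ : Fin n → R) (i : Fin n) => σ i.rev := fun σ τ h =>
    funext fun i => by simpa using congrFun h i.rev
  rw [← hinj.encard_image (recurrentWords _ n)]
  congr 1
  -- The window with indices `k, …, k + n - 1` has its leftmost point at index `k + (n - 1)`, where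
  -- the reading to the right starts.
  have key : ∀ (σ : Fin n → R) (k : ℕ), (predIn D)^[k + (n - 1)] a ∈ patternSet D σ ↔
      ∀ i : Fin n, gap D ((predIn D)^[k + i] a) = σ i.rev := by
    intro σ k
    rw [patternSet, Set.mem_ofPred_eq, and_iff_right (iterate_predIn_mem ha _)]
    refine (Fin.rev_surjective (n := n)).forall.trans (forall_congr' fun i => ?_)
    rw [iterate_succIn_iterate_predIn ha hanti (by simp only [Fin.val_rev]; omega)]
    simp only [Fin.val_rev]
    rw [show k + (n - 1) - (n - (i + 1)) = k + i by omega]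
  ext σ
  constructor
  · rintro ⟨-, h⟩
    refine ⟨fun i => σ i.rev, ?_, by simp⟩
    rw [recurrentWords, Set.mem_ofPred_eq, frequently_atTop]
    intro K
    obtain ⟨k, hk, hkσ⟩ := frequently_atTop.1 h (K + (n - 1))
    exact ⟨k - (n - 1), by omega, (key σ _).1 (by rwa [Nat.sub_add_cancel (by omega)])⟩
  · rintro ⟨τ, hτ, rfl⟩
    refine ⟨fun i => ?_, ?_⟩
    -- Index `0` is avoided: `a` may be the maximum of `D`, and its gap is then the default value
    -- `0`.
    · obtain ⟨k, hk, hkτ⟩ := frequently_atTop.1 hτ 1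
      simp only
      rw [← hkτ i.rev]
      exact gap_iterate_predIn_mem ha hanti (by omega)
    · rw [frequently_atTop]
      intro K
      obtain ⟨k, hk, hkτ⟩ := frequently_atTop.1 hτ K
      exact ⟨k + (n - 1), by omega, (key _ k).2 (by simpa using hkτ)⟩

theorem exists_rightPeriod_of_bound {D : Set R} {a : R} (ha : a ∈ D) (hfin : (diffSet D).Finite)
    {M : ℕ} (hM : ∀ x : ℕ → R, (∀ k, x k ∈ D) → StrictMono x ∨ StrictAnti x →
      ∀ n, (recurrentPatterns D x n).encard ≤ M) :
    (∀ n, (patternsUnboundedAbove D (zChain D a) n).encard ≤ M) ∧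
      (∃ l, HasRightPeriod D (zChain D a) l) ∧
      ∃ m : ℕ, (∀ᶠ n in atTop, (patternsUnboundedAbove D (zChain D a) n).encard = m) ∧
        ((¬ ∃ c, IsGreatest (zChain D a) c) → HasRightPeriod D (zChain D a) m) := by
  by_cases hZ : ∃ c, IsGreatest (zChain D a) c
  · simp only [patternsUnboundedAbove_eq_empty hZ, Set.encard_empty, zero_le, implies_true,
      true_and]
    refine ⟨?_, 0, by simp, fun h => absurd hZ h⟩
    obtain ⟨c, hc⟩ := hZ
    exact ⟨1, one_pos, c, hc.1, fun b hb hlt => absurd (hc.2 hb) (not_le.2 hlt)⟩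
  · have hmono := strictMono_iterate_succIn hZ
    have hle := hM _ (iterate_succIn_mem ha) (Or.inl hmono)
    simp only [patternsUnboundedAbove_eq hmono]
    refine ⟨hle, ?_⟩
    simp only [recurrentPatterns_iterate_succIn ha hmono] at hle ⊢
    obtain ⟨m, hm, hcard, K, hK⟩ := exists_period_of_recurrentWords (hfin.subset (by
      rintro _ ⟨k, rfl⟩
      exact gap_iterate_succIn_mem ha hmono k)) hle
    have hper : HasRightPeriod D (zChain D a) m := by
      refine ⟨hm, _, ⟨K, Or.inl rfl⟩, fun b hb hlt => ?_⟩
      obtain ⟨k, hk, rfl⟩ := exists_iterate_succIn_of_lt hb hlt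
      rw [← Function.iterate_add_apply, add_comm]
      exact hK k hk.le
    exact ⟨⟨m, hper⟩, m, hcard, fun _ => hper⟩

theorem exists_leftPeriod_of_bound {D : Set R} {a : R} (ha : a ∈ D) (hfin : (diffSet D).Finite)
    {M : ℕ} (hM : ∀ x : ℕ → R, (∀ k, x k ∈ D) → StrictMono x ∨ StrictAnti x →
      ∀ n, (recurrentPatterns D x n).encard ≤ M) :
    (∀ n, (patternsUnboundedBelow D (zChain D a) n).encard ≤ M) ∧
      (∃ l, HasLeftPeriod D (zChain D a) l) ∧
      ∃ m : ℕ, (∀ᶠ n in atTop, (patternsUnboundedBelow D (zChain D a) n).encard = m) ∧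
        ((¬ ∃ c, IsLeast (zChain D a) c) → HasLeftPeriod D (zChain D a) m) := by
  by_cases hZ : ∃ c, IsLeast (zChain D a) c
  · simp only [patternsUnboundedBelow_eq_empty hZ, Set.encard_empty, zero_le, implies_true,
      true_and]
    refine ⟨?_, 0, by simp, fun h => absurd hZ h⟩
    obtain ⟨c, hc⟩ := hZ
    exact ⟨1, one_pos, c, hc.1, fun b hb hlt => absurd (hc.2 hb) (not_le.2 hlt)⟩
  · have hanti := strictAnti_iterate_predIn hZ
    have hle := hM _ (iterate_predIn_mem ha) (Or.inr hanti)
    simp only [patternsUnboundedBelow_eq hanti]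
    refine ⟨hle, ?_⟩
    simp only [encard_recurrentPatterns_iterate_predIn ha hanti] at hle ⊢
    obtain ⟨m, hm, hcard, K, hK⟩ := exists_period_of_recurrentWords
      -- The gap at `a` itself need not belong to `D'`, since `a` may be maximal.
      ((hfin.insert (gap D a)).subset (by
        rintro _ ⟨k, rfl⟩
        rcases k.eq_zero_or_pos with rfl | hk
        · exact Set.mem_insert _ _
        · exact Set.mem_insert_of_mem _ (gap_iterate_predIn_mem ha hanti hk))) hle
    have hper : HasLeftPeriod D (zChain D a) m := by
      refine ⟨hm, _, ⟨K, Or.inr rfl⟩, fun b hb hlt => ?_⟩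
      obtain ⟨k, hk, rfl⟩ := exists_iterate_predIn_of_lt hb hlt
      rw [← Function.iterate_add_apply, add_comm]
      exact hK k hk.le
    exact ⟨⟨m, hper⟩, m, hcard, fun _ => hper⟩

end Chains

/-! ### Least uniform bounds and the conclusion. -/

theorem exists_isLeast_and_le {A : Type*} {D : Set A} {c : A → ℕ → ℕ∞} {M : ℕ}
    (hM : ∀ a ∈ D, ∀ n, c a n ≤ M) :
    ∃ m : ℕ, IsLeast {m : ℕ | ∀ a ∈ D, ∀ᶠ n in atTop, c a n ≤ m} m ∧
      ∀ a ∈ D, ∀ l : ℕ, (∀ᶠ n in atTop, c a n = l) → l ≤ m := by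
  classical
  have hne : ∃ m : ℕ, ∀ a ∈ D, ∀ᶠ n in atTop, c a n ≤ m :=
    ⟨M, fun a ha => Eventually.of_forall (hM a ha)⟩
  refine ⟨Nat.find hne, ⟨Nat.find_spec hne, fun m hm => Nat.find_min' hne hm⟩, ?_⟩
  intro a ha l hl
  obtain ⟨n, h₁, h₂⟩ := (hl.and (Nat.find_spec hne a ha)).exists
  rw [h₁] at h₂
  exact_mod_cast h₂

theorem mainTheorem5 (L : FirstOrder.Language.{u, v}) (R : Type w)
    [AddCommGroup R] [LinearOrder R] [IsOrderedAddMonoid R]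
    [TopologicalSpace R] [OrderTopology R] [L.Structure R]
    (hexp : ExpandsOAG L R)
    (hdiv : ∀ (g : R) (n : ℕ), 0 < n → ∃ h : R, n • h = g)
    (hcomplete : DefinablyComplete L R)
    (hburden : HasBurden.{u, v, w} (L.completeTheory R) 2)
    (D : Set R) (hdef : (Set.univ : Set R).Definable₁ L D) (hdisc : IsDiscrete D) :
    ∃ m₀star m₁star : ℕ,
      IsLeast {m : ℕ | ∀ a ∈ D, ∀ᶠ n in atTop,
        (patternsUnboundedAbove D (zChain D a) n).encard ≤ m} m₀star ∧
      IsLeast {m : ℕ | ∀ a ∈ D, ∀ᶠ n in atTop,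
        (patternsUnboundedBelow D (zChain D a) n).encard ≤ m} m₁star ∧
      ∀ a ∈ D, EventuallyPeriodic D (zChain D a) ∧
        ∃ m₀ m₁ : ℕ,
          (∀ᶠ n in atTop, (patternsUnboundedAbove D (zChain D a) n).encard = m₀) ∧
          (∀ᶠ n in atTop, (patternsUnboundedBelow D (zChain D a) n).encard = m₁) ∧
          m₀ ≤ m₀star ∧ m₁ ≤ m₁star ∧
          ((¬ ∃ c, IsGreatest (zChain D a) c) → HasRightPeriod D (zChain D a) m₀) ∧
          ((¬ ∃ c, IsLeast (zChain D a) c) → HasLeftPeriod D (zChain D a) m₁) := by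
  have hB := burdenLT_three hburden
  have hwo := defWellOrdered_of_isDiscrete hexp hdiv hcomplete hB hdef hdisc
  have hfin := finite_diffSet hexp hdiv hB hdef hwo
  obtain ⟨M, hM⟩ := exists_bound_recurrentPatterns hexp hdiv hB hdef hwo hfin
  obtain ⟨m₀star, h₀, hle₀⟩ := exists_isLeast_and_le
    (c := fun a n => (patternsUnboundedAbove D (zChain D a) n).encard)
    fun a ha => (exists_rightPeriod_of_bound ha hfin hM).1
  obtain ⟨m₁star, h₁, hle₁⟩ := exists_isLeast_and_le
    (c := fun a n => (patternsUnboundedBelow D (zChain D a) n).encard)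
    fun a ha => (exists_leftPeriod_of_bound ha hfin hM).1
  refine ⟨m₀star, m₁star, h₀, h₁, fun a ha => ?_⟩
  obtain ⟨-, hr, m₀, hm₀, hper₀⟩ := exists_rightPeriod_of_bound ha hfin hM
  obtain ⟨-, hl, m₁, hm₁, hper₁⟩ := exists_leftPeriod_of_bound ha hfin hM
  exact ⟨⟨hr, hl⟩, m₀, m₁, hm₀, hm₁, hle₀ a ha m₀ hm₀, hle₁ a ha m₁ hm₁, hper₀, hper₁⟩
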